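/- Let $n\ge 1$, let $\mathbb B^n=\{z\in\mathbb C^n:\|z\|<1\}$ be the Euclidean unit ball, let $e_1,\dots,e_n$ be the standard basis of $\mathbb C^n$, and $\langle\cdot,\cdot\rangle$ the standard Hermitian product, so that $z_1=\langle z,e_1\rangle$. We use the following definitions. A holomorphic map $G:\mathbb B^n\to\mathbb C^n$ is an *infinitesimal generator* if for every $z_0\in\mathbb B^n$ the Cauchy problem $\dot x(t)=G(x(t))$, $x(0)=z_0$, has a solution $x:[0,+\infty)\to\mathbb B^n$. For $R\ge1$ the *Korányi region* of vertex $e_1$ and amplitude $R$ is $K(e_1,R)=\{z\in\mathbb B^n: |1-z_1|\le \frac R2(1-\|z\|^2)\}$. A function on $\mathbb B^n$ is *bounded in any Korányi region* if for every $R\ge 1$ it is bounded on $K(e_1,R)$. A function $f:\mathbb B^n\to\mathbb C$ has *restricted $K$-limit* $L$ at $e_1$, written $\angle_K\lim_{z\to e_1}f(z)=L$, if $f(z_k)\to L$ for every sequence $\{z_k\}\subset\mathbb B^n$ converging to $e_1$ such that $\|z_k-\langle z_k,e_1\rangle e_1\|^2/(1-|\langle z_k,e_1\rangle|^2)\to0$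 and $\langle z_k,e_1\rangle\to1$ non-tangentially in the unit disc (i.e. there is $C>0$ with $|\langle z_k,e_1\rangle-1|\le C(1-|\langle z_k,e_1\rangle|^2)$ for all $k$). Let $u(z)=-\frac{1-\|z\|^2}{|1-z_1|^2}$ for $z\in\mathbb B^n$, and let $du_z$ be its real differential. The point $e_1$ is a *boundary regular null point* of an infinitesimal generator $G$ if there is $b\in\mathbb R$ with $du_z\cdot G(z)+b\,u(z)\le0$ for all $z\in\mathbb B^n$; in this case the real number $\beta=-\inf_{z\in\mathbb B^n}\frac{du_z\cdot G(z)}{u(z)}$ is the *dilation* of $G$ at $e_1$. **Theorem.** Let $G:\mathbb B^n\to\mathbb C^n$ be an infinitesimal generator. Suppose that $z\mapsto\frac{|\langle G(z),e_1\rangle|}{|z_1-1|}$ is bounded in any Korányi region, and that $z\mapsto\frac{|\langle G(z),e_j\rangle|}{|z_1-1|^{1/2}}$ is bounded in any Korányi region for $j=2,\dots,n$. Then $e_1$ is a boundary regular null point of $G$. Moreover, let $\beta\in\mathbb R$ be the dilation of $G$ at $e_1$. Then, with $(1-z_1)^{1/2}$ the principal branch, - (1$'$) $\langle dG_z(e_1),e_1\rangle$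 and $\langle dG_z(e_h),e_k\rangle$ are bounded in any Korányi region for $h,k=2,\dots,n$; - (1$''$) $\langle dG_z(e_j),e_1\rangle/(1-z_1)^{1/2}$ is bounded in any Korányi region for $j=2,\dots,n$; - (1$'''$) $(1-z_1)^{1/2}\langle dG_z(e_1),e_j\rangle$ is bounded in any Korányi region for $j=2,\dots,n$; - (2) $\angle_K\lim_{z\to e_1}\frac{\langle G(z),e_1\rangle}{z_1-1}=\beta$; - (3) $\angle_K\lim_{z\to e_1}\langle dG_z(e_1),e_1\rangle=\beta$; - (4) $\angle_K\lim_{z\to e_1}\langle dG_z(e_j),e_1\rangle=0$ for $j=2,\dots,n$. -/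

import Mathlib

open Filter Topology

noncomputable section

namespace UnitBall

/-- `ℂⁿ` with the Euclidean norm. -/
abbrev Cn (n : ℕ) : Type := EuclideanSpace ℂ (Fin n)

/-- The open unit ball `𝔹ⁿ` of `ℂⁿ`. -/
def ball (n : ℕ) : Set (Cn n) := Metric.ball 0 1

/-- The `j`-th vector of the standard basis of `ℂⁿ` (indices start at `0`, so `e 0` is the
vector usually called `e₁`). For `w : Cn n` the coordinate `w j` is `⟨w, e j⟩`. -/
def e {n : ℕ} (j : Fin n) : Cn n := EuclideanSpace.single j (1 : ℂ)

/-- A holomorphic vector field `G` on `𝔹ⁿ` is an infinitesimal generator if every Cauchy problem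
`x' = G(x)`, `x(0) = z₀ ∈ 𝔹ⁿ`, has a solution `x : [0, ∞) → 𝔹ⁿ`. Values of `G` outside the ball
are irrelevant. -/
def IsInfinitesimalGenerator {n : ℕ} (G : Cn n → Cn n) : Prop :=
  DifferentiableOn ℂ G (ball n) ∧
    ∀ z₀ ∈ ball n, ∃ x : ℝ → Cn n, x 0 = z₀ ∧
      ∀ t : ℝ, 0 ≤ t → x t ∈ ball n ∧ HasDerivWithinAt x (G (x t)) (Set.Ici 0) t

variable {n : ℕ} [NeZero n]

/-- The Korányi region of vertex `e₁` and amplitude `R`. -/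
def koranyi (n : ℕ) [NeZero n] (R : ℝ) : Set (Cn n) :=
  {z | z ∈ ball n ∧ ‖1 - z 0‖ ≤ R / 2 * (1 - ‖z‖ ^ 2)}

/-- `f` is bounded in every Korányi region of vertex `e₁` (the bound may depend on the region). -/
def BoundedInKoranyi {F : Type*} [Norm F] (f : Cn n → F) : Prop :=
  ∀ R : ℝ, 1 ≤ R → ∃ C : ℝ, ∀ z ∈ koranyi n R, ‖f z‖ ≤ C

/-- `f` has restricted `K`-limit `L` at `e₁`. -/
def HasRestrictedKLimit (f : Cn n → ℂ) (L : ℂ) : Prop :=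
  ∀ z : ℕ → Cn n, (∀ k, z k ∈ ball n) → Tendsto z atTop (𝓝 (e 0)) →
    Tendsto (fun k => ‖z k - (z k 0) • (e 0 : Cn n)‖ ^ 2 / (1 - ‖z k 0‖ ^ 2)) atTop (𝓝 0) →
    (∃ C : ℝ, 0 < C ∧ ∀ k, ‖z k 0 - 1‖ ≤ C * (1 - ‖z k 0‖ ^ 2)) →
    Tendsto (fun k => f (z k)) atTop (𝓝 L)

/-- The pluricomplex Poisson kernel of the ball with pole at `e₁`. -/
def poissonKernel (z : Cn n) : ℝ := -((1 - ‖z‖ ^ 2) / ‖1 - z 0‖ ^ 2)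

/-- `e₁` is a boundary regular null point of `G`; the differential of the kernel is the real one. -/
def IsBRNP (G : Cn n → Cn n) : Prop :=
  ∃ b : ℝ, ∀ z ∈ ball n,
    fderiv ℝ (poissonKernel (n := n)) z (G z) + b * poissonKernel z ≤ 0

/-- The dilation of `G` at `e₁`. The infimum is over a non-empty set, which is bounded below exactly
when `e₁` is a boundary regular null point of `G`. -/
def dilation (G : Cn n → Cn n) : ℝ :=
  -sInf ((fun z => fderiv ℝ (poissonKernel (n := n)) z (G z) / poissonKernel z) '' ball n)

end UnitBall

end

noncomputable section

namespace HolomorphicBall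

open Metric Set ComplexConjugate

/-! The time-`t` maps of the flow of `G` are holomorphic self-maps of the ball, so they satisfy the
Schwarz–Pick inequality. At `t = 0` it is an equality, and its right derivative there gives a
two-point inequality for `G` (`generator_two_point`).

Write `q = G₁ / (z₁ - 1)` and take the second point to be `r e₁`. Its own term equals `-(r / (1 +
r)) Re q(r e₁)`, while the hypotheses force `G(r e₁) → 0`. As `r → 1` the other terms converge to
half of `rate G z`, which is minus half the logarithmic derivative of the Poisson kernel along `G`.
Since `q` is bounded on the radius, `rate` is bounded above, so `e₁` is a boundary regular null
point. Moreover its supremum `β`, the dilation, is at most the lower limit of `Re q(r e₁)`.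

The opposite estimate comes from the slice through `e₁`. There `β - rate ≥ 0` says that `Q = (β - q)
/ (1 - ζ) - β / 2` has nonnegative real part. Combined with the radial lower bound this gives `(1 -
r) Re Q(r) → 0`. The Schwarz–Pick inequality for the half-plane then upgrades this to `(1 - ζ) Q(ζ)
→ 0` non-tangentially, imaginary part included, that is `q → β` on the slice
(`tendsto_normalQuotient_slice`).

Boundedness of `q` in Korányi regions carries the limit from the slice to restricted sequences, by
the Schwarz lemma on large transverse discs (`hasRestrictedKLimit_of_slice`). The derivative bounds
are Cauchy estimates on discs of radius comparable to `|1 - z₁|` in the normal direction and to `|1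
- z₁|^(1/2)` in tangential ones. The limit of the normal derivative follows from `∂₁G₁ = q + (z₁ -
1) ∂₁q` and a Cauchy estimate for `q - β`; the tangential limit follows from the bound `O(|1 -
z₁|^(1/2))`. -/

lemma one_sub_norm_sq_pos {E : Type*} [NormedAddCommGroup E] {z : E} (hz : ‖z‖ < 1) :
    0 < 1 - ‖z‖ ^ 2 := by
  nlinarith [norm_nonneg z]

/-! ### Automorphisms of the ball and the Schwarz–Pick inequality. -/

section SchwarzPick

variable {E F : Type*} [NormedAddCommGroup E] [InnerProductSpace ℂ E]
  [NormedAddCommGroup F] [InnerProductSpace ℂ F]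

/-- The involutive automorphism of the unit ball exchanging `0` and `p`. -/
def mobius (p z : E) : E :=
  (1 - inner ℂ p z)⁻¹ •
    (p - ((√(1 - ‖p‖ ^ 2) : ℝ) : ℂ) • z - (inner ℂ p z / (1 + (√(1 - ‖p‖ ^ 2) : ℝ))) • p)

lemma one_sub_inner_ne_zero {p z : E} (hp : ‖p‖ < 1) (hz : ‖z‖ < 1) :
    1 - inner ℂ p z ≠ 0 := by
  intro h
  have h1 : inner ℂ p z = 1 := (sub_eq_zero.1 h).symm
  have h2 := norm_inner_le_norm (𝕜 := ℂ) p z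
  rw [h1, norm_one] at h2
  nlinarith [norm_nonneg p, norm_nonneg z]

/-- With `s² = 1 - ‖p‖²`, expanding the squared norm of the numerator of `mobius p z` gives `|1 -
⟨p, z⟩|² - s² (1 - ‖z‖²)`. -/
lemma one_sub_norm_sq_mobius {p z : E} (hp : ‖p‖ < 1) (hz : ‖z‖ < 1) :
    (1 - ‖mobius p z‖ ^ 2) * ‖1 - inner ℂ p z‖ ^ 2 = (1 - ‖p‖ ^ 2) * (1 - ‖z‖ ^ 2) := by
  have hne := one_sub_inner_ne_zero hp hz
  have hs0 : 0 ≤ √(1 - ‖p‖ ^ 2) := Real.sqrt_nonneg _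
  have hs : √(1 - ‖p‖ ^ 2) ^ 2 = 1 - ‖p‖ ^ 2 :=
    Real.sq_sqrt (one_sub_norm_sq_pos hp).le
  set s := √(1 - ‖p‖ ^ 2) with hsdef
  set c := inner ℂ p z with hc
  have hnum : ‖p - (s : ℂ) • z - (c / (1 + s)) • p‖ ^ 2 =
      ‖1 - c‖ ^ 2 - s ^ 2 * (1 - ‖z‖ ^ 2) := by
    have hs1 : (1 + s) ≠ 0 := by positivity
    have hs1' : (1 + s : ℂ) ≠ 0 := by exact_mod_cast hs1
    have hpp : (inner ℂ p p : ℂ) = 1 - (s : ℂ) ^ 2 := by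
      rw [inner_self_eq_norm_sq_to_K]
      have : ((‖p‖ ^ 2 : ℝ) : ℂ) = ((1 - s ^ 2 : ℝ) : ℂ) := by rw [hs]; ring_nf
      simpa using this
    have hzp : (inner ℂ z p : ℂ) = conj c := by rw [hc, inner_conj_symm]
    have hzz : (inner ℂ z z : ℂ) = (‖z‖ : ℂ) ^ 2 := inner_self_eq_norm_sq_to_K z
    have key : ((‖p - (s : ℂ) • z - (c / (1 + s)) • p‖ ^ 2 : ℝ) : ℂ) =
        ((‖1 - c‖ ^ 2 - s ^ 2 * (1 - ‖z‖ ^ 2) : ℝ) : ℂ) := by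
      push_cast
      rw [← Complex.conj_mul' (1 - c)]
      have := inner_self_eq_norm_sq_to_K (𝕜 := ℂ) (p - (s : ℂ) • z - (c / (1 + s)) • p)
      simp only [Complex.coe_algebraMap] at this
      rw [← this]
      simp only [inner_sub_left, inner_sub_right, inner_smul_left, inner_smul_right, hpp, hzp,
        hzz, ← hc, map_div₀, map_add, map_sub, map_one, Complex.conj_ofReal]
      field_simp
      ring
    exact_mod_cast key
  have h1 : ‖1 - c‖ ≠ 0 := norm_ne_zero_iff.2 hne
  rw [mobius, ← hsdef, ← hc, norm_smul, norm_inv, mul_pow, hnum, ← hs]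
  field_simp
  ring

lemma norm_mobius_lt_one {p z : E} (hp : ‖p‖ < 1) (hz : ‖z‖ < 1) : ‖mobius p z‖ < 1 := by
  have h := one_sub_norm_sq_mobius hp hz
  have h1 : 0 < ‖1 - inner ℂ p z‖ ^ 2 :=
    pow_pos (norm_pos_iff.2 (one_sub_inner_ne_zero hp hz)) 2
  have h2 : 0 < (1 - ‖mobius p z‖ ^ 2) * ‖1 - inner ℂ p z‖ ^ 2 := by
    rw [h]; exact mul_pos (one_sub_norm_sq_pos hp) (one_sub_norm_sq_pos hz)
  have h3 := pos_of_mul_pos_left h2 h1.le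
  nlinarith [norm_nonneg (mobius p z)]

lemma mobius_zero (p : E) : mobius p 0 = p := by simp [mobius]

/-- The denominator of the second application is `s² / (1 - ⟨p, z⟩)`; it remains to compare the
coefficients of `p` and `z`. -/
lemma mobius_mobius {p z : E} (hp : ‖p‖ < 1) (hz : ‖z‖ < 1) : mobius p (mobius p z) = z := by
  have hne := one_sub_inner_ne_zero hp hz
  have hspos : 0 < √(1 - ‖p‖ ^ 2) := Real.sqrt_pos.2 (one_sub_norm_sq_pos hp)
  have hs : √(1 - ‖p‖ ^ 2) ^ 2 = 1 - ‖p‖ ^ 2 :=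
    Real.sq_sqrt (one_sub_norm_sq_pos hp).le
  have hi : inner ℂ p (mobius p z) =
      1 - ((√(1 - ‖p‖ ^ 2) : ℝ) : ℂ) ^ 2 / (1 - inner ℂ p z) := by
    have hpp : (inner ℂ p p : ℂ) = 1 - ((√(1 - ‖p‖ ^ 2) : ℝ) : ℂ) ^ 2 := by
      rw [inner_self_eq_norm_sq_to_K]
      have : ((‖p‖ ^ 2 : ℝ) : ℂ) = ((1 - √(1 - ‖p‖ ^ 2) ^ 2 : ℝ) : ℂ) := by rw [hs]; ring_nf
      simpa using this
    have hs1' : (1 + (√(1 - ‖p‖ ^ 2) : ℝ) : ℂ) ≠ 0 := by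
      exact_mod_cast (by positivity : 1 + √(1 - ‖p‖ ^ 2) ≠ 0)
    rw [mobius]
    simp only [inner_sub_right, inner_smul_right, hpp]
    field_simp
    ring
  have hs0 : ((√(1 - ‖p‖ ^ 2) : ℝ) : ℂ) ≠ 0 := by exact_mod_cast hspos.ne'
  have hs1 : (1 + (√(1 - ‖p‖ ^ 2) : ℝ) : ℂ) ≠ 0 := by
    exact_mod_cast (by positivity : 1 + √(1 - ‖p‖ ^ 2) ≠ 0)
  rw [mobius, hi, mobius]
  generalize ((√(1 - ‖p‖ ^ 2) : ℝ) : ℂ) = s at *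
  generalize (inner ℂ p z : ℂ) = c at *
  have hs2 : 1 - (1 - s ^ 2 / (1 - c)) ≠ 0 := by
    rw [sub_sub_cancel]
    exact div_ne_zero (pow_ne_zero 2 hs0) hne
  rw [inv_smul_eq_iff₀ hs2]
  match_scalars
  · field_simp
    ring
  · field_simp
    ring

lemma mobius_self {p : E} (hp : ‖p‖ < 1) : mobius p p = 0 := by
  have h := mobius_mobius hp (z := 0) (by simp)
  rwa [mobius_zero] at h

lemma differentiableOn_mobius {p : E} (hp : ‖p‖ < 1) :
    DifferentiableOn ℂ (mobius p) (ball 0 1) := by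
  intro z hz
  have hz' : ‖z‖ < 1 := by simpa using hz
  have hin : DifferentiableAt ℂ (fun z : E => (inner ℂ p z : ℂ)) z :=
    (innerSL ℂ p).differentiableAt
  apply DifferentiableAt.differentiableWithinAt
  unfold mobius
  refine DifferentiableAt.smul ?_ ?_
  · exact ((differentiableAt_const _).sub hin).inv (one_sub_inner_ne_zero hp hz')
  · refine DifferentiableAt.sub ?_ (DifferentiableAt.smul_const ?_ p)
    · exact (differentiableAt_const _).sub (differentiableAt_id.const_smul _)
    · simp only [div_eq_mul_inv]
      exact hin.mul_const _

/-- The Schwarz–Pick inequality between unit balls, for maps that are holomorphic along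
holomorphic discs. -/
theorem schwarz_pick {f : E → F}
    (hf : ∀ γ : ℂ → E, DifferentiableOn ℂ γ (ball 0 1) → MapsTo γ (ball 0 1) (ball 0 1) →
      DifferentiableOn ℂ (f ∘ γ) (ball 0 1))
    (hmaps : MapsTo f (ball 0 1) (ball 0 1)) {z w : E} (hz : ‖z‖ < 1) (hw : ‖w‖ < 1) :
    ‖1 - inner ℂ (f w) (f z)‖ ^ 2 * ((1 - ‖z‖ ^ 2) * (1 - ‖w‖ ^ 2)) ≤
      ‖1 - inner ℂ w z‖ ^ 2 * ((1 - ‖f z‖ ^ 2) * (1 - ‖f w‖ ^ 2)) := by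
  have hfz : ‖f z‖ < 1 := by simpa using hmaps (by simpa using hz)
  have hfw : ‖f w‖ < 1 := by simpa using hmaps (by simpa using hw)
  set v := mobius w z with hv
  have hv1 : ‖v‖ < 1 := norm_mobius_lt_one hw hz
  -- The direction of `v`; when `v = 0` the inverse is `0` and `u = 0`, whence only `‖u‖ ≤ 1`.
  set u : E := ((‖v‖ : ℂ)⁻¹) • v with hu
  have hu1 : ‖u‖ ≤ 1 := by
    rw [hu, norm_smul, norm_inv, Complex.norm_real, norm_norm]
    exact inv_mul_le_one
  have hvu : (‖v‖ : ℂ) • u = v := by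
    rcases eq_or_ne v 0 with h | h
    · simp [h]
    · rw [hu, smul_inv_smul₀]
      exact_mod_cast norm_ne_zero_iff.2 h
  have hline : MapsTo (fun l : ℂ => l • u) (ball 0 1) (ball 0 1) := by
    intro l hl
    simp only [mem_ball_zero_iff] at hl ⊢
    rw [norm_smul]
    exact (mul_le_of_le_one_right (norm_nonneg _) hu1).trans_lt hl
  set γ : ℂ → E := fun l => mobius w (l • u) with hγ
  have hγd : DifferentiableOn ℂ γ (ball 0 1) :=
    (differentiableOn_mobius hw).comp
      (differentiable_id.smul_const u).differentiableOn hline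
  have hγm : MapsTo γ (ball 0 1) (ball 0 1) := fun l hl => by
    have := hline hl
    simp only [mem_ball_zero_iff] at this ⊢
    exact norm_mobius_lt_one hw this
  have hγ0 : γ 0 = w := by simp [hγ, mobius_zero]
  have hγv : γ (‖v‖ : ℂ) = z := by
    simp only [hγ]
    rw [hvu, hv, mobius_mobius hw hz]
  -- The disc `γ` passes through `w` at `0` and `z` at `‖v‖`, so the one-variable Schwarz lemma
  -- applies once `f w` is moved to `0`.
  have hS := Complex.norm_le_norm_of_mapsTo_ball (R := 1) (z := (‖v‖ : ℂ))
    (f := fun l => mobius (f w) ((f ∘ γ) l))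
    ((differentiableOn_mobius hfw).comp (hf γ hγd hγm) (hmaps.comp hγm))
    (fun l hl => by
      have := hmaps (hγm hl)
      simp only [mem_ball_zero_iff, mem_closedBall_zero_iff] at this ⊢
      exact (norm_mobius_lt_one hfw this).le)
    (by simp [hγ0, mobius_self hfw]) (by simpa using hv1)
  simp only [Function.comp, hγv, Complex.norm_real, norm_norm] at hS
  have e1 := one_sub_norm_sq_mobius hw hz
  have e2 := one_sub_norm_sq_mobius hfw hfz
  rw [← hv] at e1
  have h3 : 1 - ‖v‖ ^ 2 ≤ 1 - ‖mobius (f w) (f z)‖ ^ 2 := by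
    have := pow_le_pow_left₀ (norm_nonneg _) hS 2
    linarith
  have h4 := mul_le_mul_of_nonneg_right h3
    (by positivity : 0 ≤ ‖1 - inner ℂ w z‖ ^ 2 * ‖1 - inner ℂ (f w) (f z)‖ ^ 2)
  calc _ = (1 - ‖v‖ ^ 2) * (‖1 - inner ℂ w z‖ ^ 2 * ‖1 - inner ℂ (f w) (f z)‖ ^ 2) := by
        rw [← mul_assoc (1 - ‖v‖ ^ 2), e1]; ring
    _ ≤ _ := h4
    _ = _ := by
        rw [mul_left_comm, e2]; ring

end SchwarzPick

end HolomorphicBall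
end

noncomputable section

namespace HolomorphicBall

open Metric Set

/-! ### Holomorphic dependence of the flow on its initial value. -/

section Flow

variable {E : Type*} [NormedAddCommGroup E] [NormedSpace ℂ E]

/-- A solution of `x' = G(x)` staying in the unit ball for all nonnegative times. -/
def IsTrajectory (G : E → E) (x : ℝ → E) : Prop :=
  ∀ t : ℝ, 0 ≤ t → x t ∈ ball (0 : E) 1 ∧ HasDerivWithinAt x (G (x t)) (Ici 0) t

lemma IsTrajectory.continuousOn {G : E → E} {x : ℝ → E} (hx : IsTrajectory G x) :
    ContinuousOn x (Ici 0) :=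
  fun t ht => (hx t ht).2.continuousWithinAt

lemma IsTrajectory.hasDerivWithinAt_Ici {G : E → E} {x : ℝ → E} (hx : IsTrajectory G x) {t : ℝ}
    (ht : 0 ≤ t) : HasDerivWithinAt x (G (x t)) (Ici t) t :=
  (hx t ht).2.mono (Ici_subset_Ici.2 ht)

/-- First and second order Taylor estimates for a bounded holomorphic map. -/
lemma taylor_bounds {G : E → E} {x : E} {δ M : ℝ} (hδ : 0 < δ)
    (hd : DifferentiableOn ℂ G (ball x δ)) (hM : ∀ y ∈ ball x δ, ‖G y‖ ≤ M) :
    ‖fderiv ℂ G x‖ ≤ 2 * M / δ ∧ ∀ y ∈ ball x δ,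
      ‖G y - G x‖ ≤ 2 * M / δ * ‖y - x‖ ∧
      ‖G y - G x - fderiv ℂ G x (y - x)‖ ≤ 4 * M / δ ^ 2 * ‖y - x‖ ^ 2 := by
  have hx : x ∈ ball x δ := mem_ball_self hδ
  have hmaps : MapsTo G (ball x δ) (closedBall (G x) (2 * M)) := by
    intro y hy
    rw [mem_closedBall, dist_eq_norm]
    linarith [norm_sub_le (G y) (G x), hM y hy, hM x hx]
  have hfd : ‖fderiv ℂ G x‖ ≤ 2 * M / δ := Complex.norm_fderiv_le_div_of_mapsTo_ball hd hmaps hδ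
  refine ⟨hfd, fun y hy => ⟨?_, ?_⟩⟩
  · simpa [dist_eq_norm] using Complex.dist_le_div_mul_dist_of_mapsTo_ball hd hmaps hy
  · have hGx : HasFDerivAt G (fderiv ℂ G x) x :=
      (hd.differentiableAt (isOpen_ball.mem_nhds hx)).hasFDerivAt
    -- Schwarz lemma of order two for `G` minus its linear part: the increment of `G` and that of
    -- the linear part are each at most `2 * M`, hence `4 * M`.
    have key := Complex.dist_le_mul_div_pow_of_mapsTo_ball_of_isLittleO (n := 1)
      (f := fun y => G y - fderiv ℂ G x y) (c := x) (z := y) (R₁ := δ) (R₂ := 4 * M)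
      (hd.sub (fderiv ℂ G x).differentiable.differentiableOn) ?_ ?_ hy
    · rw [dist_eq_norm, dist_eq_norm] at key
      convert key using 1
      · rw [map_sub]; congr 1; abel
      · rw [div_pow]
        ring
    · intro w hw
      rw [mem_closedBall, dist_eq_norm]
      have e1 : G w - fderiv ℂ G x w - (G x - fderiv ℂ G x x) =
          (G w - G x) - fderiv ℂ G x (w - x) := by rw [map_sub]; abel
      have h1 : ‖G w - G x‖ ≤ 2 * M := by simpa [dist_eq_norm] using hmaps hw
      have h2 : ‖fderiv ℂ G x (w - x)‖ ≤ 2 * M := by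
        refine ((fderiv ℂ G x).le_opNorm _).trans ?_
        have h3 : ‖w - x‖ ≤ δ := by rw [← dist_eq_norm]; exact (mem_ball.1 hw).le
        have hM0 : 0 ≤ M := (norm_nonneg _).trans (hM x hx)
        calc ‖fderiv ℂ G x‖ * ‖w - x‖ ≤ 2 * M / δ * δ := by gcongr
          _ = 2 * M := by field_simp
      simp only [e1]
      linarith [norm_sub_le (G w - G x) (fderiv ℂ G x (w - x))]
    · have := hGx.isLittleO
      refine (this.norm_right.congr (fun w => ?_) (fun w => ?_))
      · rw [map_sub]; abel
      · simp

/-- Uniform Taylor estimates along a compact piece of a trajectory. -/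
lemma IsTrajectory.exists_taylor_bounds [FiniteDimensional ℂ E] {G : E → E}
    (hG : DifferentiableOn ℂ G (ball 0 1)) {x : ℝ → E} (hx : IsTrajectory G x) {T : ℝ}
    (hT : 0 ≤ T) :
    ∃ δ > 0, ∃ K > 0, ∃ L > 0, ∀ t ∈ Icc 0 T, ‖fderiv ℂ G (x t)‖ ≤ K ∧ ∀ y ∈ ball (x t) δ,
      ‖G y - G (x t)‖ ≤ K * ‖y - x t‖ ∧
      ‖G y - G (x t) - fderiv ℂ G (x t) (y - x t)‖ ≤ L * ‖y - x t‖ ^ 2 := by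
  have : ProperSpace E := FiniteDimensional.proper ℂ E
  obtain ⟨t₀, ht₀, hmax⟩ := isCompact_Icc.exists_isMaxOn (nonempty_Icc.2 hT)
    ((hx.continuousOn.mono Icc_subset_Ici_self).norm)
  have hρ : ‖x t₀‖ < 1 := by simpa using (hx t₀ ht₀.1).1
  set δ := (1 - ‖x t₀‖) / 2 with hδ
  have hδ0 : 0 < δ := by rw [hδ]; linarith
  have hsub : closedBall (0 : E) (‖x t₀‖ + δ) ⊆ ball 0 1 :=
    closedBall_subset_ball (by rw [hδ]; linarith)
  obtain ⟨M, hM⟩ := (isCompact_closedBall (0 : E) (‖x t₀‖ + δ)).exists_bound_of_continuousOn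
    (hG.continuousOn.mono hsub)
  have hM0 : 0 ≤ M := (norm_nonneg _).trans (hM 0 (mem_closedBall_self (by positivity)))
  -- `M + 1` instead of `M` makes the constants strictly positive.
  refine ⟨δ, hδ0, 2 * (M + 1) / δ, by positivity, 4 * (M + 1) / δ ^ 2, by positivity,
    fun t ht => ?_⟩
  have hb : ball (x t) δ ⊆ closedBall (0 : E) (‖x t₀‖ + δ) := by
    intro y hy
    rw [mem_closedBall_zero_iff]
    have h1 : ‖x t‖ ≤ ‖x t₀‖ := hmax ht
    have h2 : ‖y - x t‖ < δ := by rwa [← dist_eq_norm]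
    linarith [norm_le_norm_add_norm_sub' y (x t)]
  exact taylor_bounds hδ0 (hG.mono (hb.trans hsub)) fun y hy => (hM y (hb hy)).trans (by linarith)

/-- Nearby trajectories stay nearby on a bounded time interval. -/
lemma IsTrajectory.norm_sub_le {G : E → E} {x y : ℝ → E} (hx : IsTrajectory G x)
    (hy : IsTrajectory G y) {T δ K d : ℝ} (hd : 0 < d) (hK : 0 < K)
    (hdδ : d * Real.exp ((K + 1) * T) < δ) (h0 : ‖y 0 - x 0‖ ≤ d)
    (hLip : ∀ t ∈ Icc 0 T, ∀ w ∈ ball (x t) δ, ‖G w - G (x t)‖ ≤ K * ‖w - x t‖) :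
    ∀ t ∈ Icc 0 T, ‖y t - x t‖ ≤ d * Real.exp ((K + 1) * t) := by
  -- The exponent `K + 1` exceeds the Lipschitz constant `K`, so the barrier grows strictly faster
  -- at any contact; `hdδ` keeps contact points where the Lipschitz bound holds.
  have key := image_norm_le_of_norm_deriv_right_lt_deriv_boundary (a := 0) (b := T)
    (f := fun t => y t - x t) (f' := fun t => G (y t) - G (x t))
    (B := fun t => d * Real.exp ((K + 1) * t))
    (B' := fun t => d * (Real.exp ((K + 1) * t) * ((K + 1) * 1)))
    ((hy.continuousOn.sub hx.continuousOn).mono Icc_subset_Ici_self)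
    (fun t ht => (hy.hasDerivWithinAt_Ici ht.1).sub (hx.hasDerivWithinAt_Ici ht.1))
    (by simpa using h0)
    (fun t => (((hasDerivAt_id t).const_mul (K + 1)).exp.const_mul d))
    (fun t ht heq => ?_)
  · exact fun t ht => key ht
  · have hexp : 0 < Real.exp ((K + 1) * t) := Real.exp_pos _
    have hlt : d * Real.exp ((K + 1) * t) < δ := by
      refine lt_of_le_of_lt ?_ hdδ
      have := ht.2.le
      gcongr
    have hw : y t ∈ ball (x t) δ := by rw [mem_ball, dist_eq_norm, heq]; exact hlt
    refine (hLip t ⟨ht.1, ht.2.le⟩ _ hw).trans_lt ?_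
    rw [heq]
    nlinarith [mul_pos hd hexp]

/-- Solutions depend holomorphically on a holomorphic family of initial values. -/
theorem differentiableAt_flow [FiniteDimensional ℂ E] {G : E → E}
    (hG : DifferentiableOn ℂ G (ball 0 1)) {X : E → ℝ → E}
    (hX0 : ∀ z ∈ ball (0 : E) 1, X z 0 = z) (hX : ∀ z ∈ ball (0 : E) 1, IsTrajectory G (X z))
    {γ : ℂ → E} {a : ℂ} (hγ : DifferentiableAt ℂ γ a) (hγm : ∀ᶠ s in 𝓝 a, γ s ∈ ball (0 : E) 1)
    {T : ℝ} (hT : 0 ≤ T) : DifferentiableAt ℂ (fun s => X (γ s) T) a := by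
  have : CompleteSpace E := FiniteDimensional.complete ℂ E
  have ha : γ a ∈ ball (0 : E) 1 := hγm.self_of_nhds
  set x := X (γ a) with hx
  have hxt : IsTrajectory G x := hX _ ha
  have hx0 : x 0 = γ a := hX0 _ ha
  obtain ⟨δ, hδ, K, hK, L, hL, hb⟩ := hxt.exists_taylor_bounds hG hT
  obtain ⟨M, hM, hγL⟩ : ∃ M > 0, ∀ᶠ s in 𝓝 a, ‖γ s - γ a‖ ≤ M * ‖s - a‖ := by
    obtain ⟨M, hM, h⟩ := hγ.hasFDerivAt.isBigO_sub.exists_pos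
    exact ⟨M, hM, h.bound⟩
  set A := M * Real.exp ((K + 1) * T) with hA
  have hA0 : 0 < A := by positivity
  have hsmall : ∀ᶠ s in 𝓝 a, ‖s - a‖ * A < δ := by
    have : Tendsto (fun s : ℂ => ‖s - a‖ * A) (𝓝 a) (𝓝 0) := by
      have h : Continuous fun s : ℂ => ‖s - a‖ * A := by fun_prop
      simpa using h.tendsto a
    exact this.eventually (gt_mem_nhds hδ)
  -- the difference quotients and their approximate linear equation
  set q : ℂ → ℝ → E := fun s t => (s - a)⁻¹ • (X (γ s) t - x t) with hq
  set q' : ℂ → ℝ → E := fun s t => (s - a)⁻¹ • (G (X (γ s) t) - G (x t)) with hq'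
  have hgood : ∀ᶠ s in 𝓝[≠] a, γ s ∈ ball (0 : E) 1 ∧ ∀ t ∈ Icc 0 T,
      ‖q' s t - fderiv ℂ G (x t) (q s t)‖ ≤ L * A ^ 2 * ‖s - a‖ := by
    filter_upwards [nhdsWithin_le_nhds hγm, nhdsWithin_le_nhds hγL, nhdsWithin_le_nhds hsmall,
      self_mem_nhdsWithin] with s hs1 hs2 hs3 hs4
    refine ⟨hs1, fun t ht => ?_⟩
    have hne : s - a ≠ 0 := sub_ne_zero.2 hs4
    have hpos : 0 < ‖s - a‖ := norm_pos_iff.2 hne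
    have h1 : ∀ t ∈ Icc 0 T, ‖X (γ s) t - x t‖ ≤ M * ‖s - a‖ * Real.exp ((K + 1) * t) :=
      hxt.norm_sub_le (hX _ hs1) (d := M * ‖s - a‖) (by positivity) hK
        (by rw [hA] at hs3; linarith) (by rw [hX0 _ hs1, hx0]; exact hs2)
        (fun t ht w hw => ((hb t ht).2 w hw).1)
    have h2 : ‖X (γ s) t - x t‖ ≤ A * ‖s - a‖ := by
      refine (h1 t ht).trans ?_
      have : Real.exp ((K + 1) * t) ≤ Real.exp ((K + 1) * T) := by
        have := ht.2
        gcongr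
      rw [hA]
      nlinarith [mul_pos hM hpos]
    have h3 := ((hb t ht).2 (X (γ s) t) (by
      rw [mem_ball, dist_eq_norm]; linarith)).2
    have e1 : q' s t - fderiv ℂ G (x t) (q s t) = (s - a)⁻¹ •
        (G (X (γ s) t) - G (x t) - fderiv ℂ G (x t) (X (γ s) t - x t)) := by
      simp only [hq, hq', ContinuousLinearMap.map_smul]
      rw [← smul_sub]
    rw [e1, norm_smul, norm_inv, inv_mul_le_iff₀ hpos]
    refine h3.trans ?_
    have := pow_le_pow_left₀ (norm_nonneg _) h2 2
    nlinarith
  -- The limit of the quotients need not be identified. Two of them solve the same linearised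
  -- equation up to small errors with nearly equal initial values, so Grönwall makes their
  -- difference small.
  have hcauchy : Cauchy (map (fun s => q s T) (𝓝[≠] a)) := by
    rw [Metric.cauchy_iff]
    refine ⟨map_neBot, fun ε hε => ?_⟩
    have hslope : Tendsto (fun s => q s 0) (𝓝[≠] a) (𝓝 (deriv γ a)) := by
      have := hasDerivAt_iff_tendsto_slope.1 hγ.hasDerivAt
      refine this.congr' ?_
      filter_upwards [nhdsWithin_le_nhds hγm] with s hs
      simp only [hq, hX0 _ hs, hx0, slope_def_module]
    obtain ⟨η, hη, hηε⟩ : ∃ η > 0, gronwallBound η K η T < ε := by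
      have h : Tendsto (fun η => gronwallBound η K η T) (𝓝[>] 0) (𝓝 (gronwallBound 0 K 0 T)) := by
        have hc : Continuous fun η : ℝ => gronwallBound η K η T := by
          rw [show (fun η : ℝ => gronwallBound η K η T) = fun η =>
            η * Real.exp (K * T) + η / K * (Real.exp (K * T) - 1) from
            funext fun η => by rw [gronwallBound_of_K_ne_0 hK.ne']]
          fun_prop
        exact (hc.tendsto 0).mono_left nhdsWithin_le_nhds
      rw [gronwallBound_ε0_δ0] at h
      obtain ⟨η, h1, h2⟩ := ((h.eventually (gt_mem_nhds hε)).and self_mem_nhdsWithin).exists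
      exact ⟨η, h2, h1⟩
    have hlin : ∀ᶠ s in 𝓝[≠] a, L * A ^ 2 * ‖s - a‖ < η / 2 := by
      have : Tendsto (fun s : ℂ => L * A ^ 2 * ‖s - a‖) (𝓝 a) (𝓝 0) := by
        have h : Continuous fun s : ℂ => L * A ^ 2 * ‖s - a‖ := by fun_prop
        simpa using h.tendsto a
      exact nhdsWithin_le_nhds (this.eventually (gt_mem_nhds (half_pos hη)))
    have hinit : ∀ᶠ s in 𝓝[≠] a, ‖q s 0 - deriv γ a‖ < η / 2 := by
      have := (Metric.tendsto_nhds.1 hslope) (η / 2) (half_pos hη)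
      simpa [dist_eq_norm] using this
    refine ⟨_, image_mem_map ((hgood.and hlin).and hinit), ?_⟩
    rintro _ ⟨s, ⟨⟨⟨hs1, hs2⟩, hs3⟩, hs4⟩, rfl⟩ _ ⟨r, ⟨⟨⟨hr1, hr2⟩, hr3⟩, hr4⟩, rfl⟩
    rw [dist_eq_norm]
    have hder : ∀ s, γ s ∈ ball (0 : E) 1 → ∀ t, 0 ≤ t →
        HasDerivWithinAt (q s) (q' s t) (Ici t) t := fun s hs t ht =>
      (((hX _ hs).hasDerivWithinAt_Ici ht).sub (hxt.hasDerivWithinAt_Ici ht)).const_smul _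
    have hcont : ∀ s, γ s ∈ ball (0 : E) 1 → ContinuousOn (q s) (Icc 0 T) := fun s hs =>
      (((hX _ hs).continuousOn.sub hxt.continuousOn).const_smul _).mono Icc_subset_Ici_self
    have key := norm_le_gronwallBound_of_norm_deriv_right_le (a := 0) (b := T) (K := K) (δ := η)
      (ε := η) (f := fun t => q s t - q r t) (f' := fun t => q' s t - q' r t)
      ((hcont s hs1).sub (hcont r hr1))
      (fun t ht => (hder s hs1 t ht.1).sub (hder r hr1 t ht.1))
      (by
        have : q s 0 - q r 0 = (q s 0 - deriv γ a) - (q r 0 - deriv γ a) := by abel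
        rw [this]
        linarith [norm_sub_le (q s 0 - deriv γ a) (q r 0 - deriv γ a)])
      (fun t ht => by
        have ht' : t ∈ Icc 0 T := ⟨ht.1, ht.2.le⟩
        have e1 : q' s t - q' r t = fderiv ℂ G (x t) (q s t - q r t) +
            ((q' s t - fderiv ℂ G (x t) (q s t)) - (q' r t - fderiv ℂ G (x t) (q r t))) := by
          rw [map_sub]; abel
        rw [e1]
        have h1 := hs2 t ht'
        have h2 := hr2 t ht'
        have h3 := (fderiv ℂ G (x t)).le_of_opNorm_le (hb t ht').1 (q s t - q r t)
        have h4 := norm_add_le (fderiv ℂ G (x t) (q s t - q r t))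
          ((q' s t - fderiv ℂ G (x t) (q s t)) - (q' r t - fderiv ℂ G (x t) (q r t)))
        have h5 := norm_sub_le (q' s t - fderiv ℂ G (x t) (q s t))
          (q' r t - fderiv ℂ G (x t) (q r t))
        linarith) T ⟨hT, le_rfl⟩
    rw [sub_zero] at key
    exact key.trans_lt hηε
  obtain ⟨l, hl⟩ := CompleteSpace.complete hcauchy
  have hder : HasDerivAt (fun s => X (γ s) T) l a := by
    rw [hasDerivAt_iff_tendsto_slope]
    refine Tendsto.congr (fun s => ?_) (hl : Tendsto (fun s => q s T) (𝓝[≠] a) (𝓝 l))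
    simp only [hq, hx, slope_def_module]
  exact hder.differentiableAt

end Flow

/-! ### The infinitesimal Schwarz–Pick inequality. -/

section TwoPoint

variable {E : Type*} [NormedAddCommGroup E] [InnerProductSpace ℂ E]

lemma hasDerivWithinAt_norm_sq_inner {x : ℝ → E} {x' : E} {s : Set ℝ} {t : ℝ}
    (hx : HasDerivWithinAt x x' s t) :
    HasDerivWithinAt (fun t => ‖x t‖ ^ 2) (2 * (inner ℂ (x t) x').re) s t := by
  have h := (Complex.reCLM.hasFDerivAt.comp_hasDerivWithinAt t (hx.inner ℂ hx))
  have e1 : ∀ v : E, (inner ℂ v v : ℂ).re = ‖v‖ ^ 2 := fun v => by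
    simpa using inner_self_eq_norm_sq (𝕜 := ℂ) v
  have e2 : (inner ℂ x' (x t) : ℂ).re = (inner ℂ (x t) x').re := by
    simpa using inner_re_symm (𝕜 := ℂ) x' (x t)
  refine (h.congr_deriv ?_).congr_of_eventuallyEq ?_ ?_
  · simp [e2]
    ring
  · exact Eventually.of_forall fun t => (e1 (x t)).symm
  · exact (e1 (x t)).symm

lemma nonpos_of_hasDerivWithinAt_Ici {f : ℝ → ℝ} {f' a : ℝ} (hf : HasDerivWithinAt f f' (Ici a) a)
    (h : ∀ t, a ≤ t → f t ≤ f a) : f' ≤ 0 := by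
  have hs := (hasDerivWithinAt_iff_tendsto_slope.1 hf)
  rw [Ici_sdiff_left] at hs
  refine le_of_tendsto hs ?_
  filter_upwards [self_mem_nhdsWithin] with t ht
  rw [slope_def_field]
  exact div_nonpos_of_nonpos_of_nonneg (sub_nonpos.2 (h t (le_of_lt ht))) (sub_nonneg.2 (le_of_lt ht))

/-- Infinitesimal form of the Schwarz–Pick inequality for a semicomplete holomorphic field. -/
theorem generator_two_point [FiniteDimensional ℂ E] {G : E → E}
    (hG : DifferentiableOn ℂ G (ball 0 1))
    (hsol : ∀ z ∈ ball (0 : E) 1, ∃ x : ℝ → E, x 0 = z ∧ IsTrajectory G x)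
    {z w : E} (hz : ‖z‖ < 1) (hw : ‖w‖ < 1) :
    (inner ℂ z (G z)).re / (1 - ‖z‖ ^ 2) + (inner ℂ w (G w)).re / (1 - ‖w‖ ^ 2) ≤
      ((inner ℂ w (G z) + inner ℂ (G w) z) / (1 - inner ℂ w z)).re := by
  choose! X hX0 hX using hsol
  have hz' : z ∈ ball (0 : E) 1 := by simpa using hz
  have hw' : w ∈ ball (0 : E) 1 := by simpa using hw
  have hpick : ∀ t : ℝ, 0 ≤ t →
      ‖1 - inner ℂ (X w t) (X z t)‖ ^ 2 * ((1 - ‖z‖ ^ 2) * (1 - ‖w‖ ^ 2)) ≤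
      ‖1 - inner ℂ w z‖ ^ 2 * ((1 - ‖X z t‖ ^ 2) * (1 - ‖X w t‖ ^ 2)) := by
    intro t ht
    refine schwarz_pick (f := fun p => X p t) (fun γ hγ hγm s hs => ?_)
      (fun p hp => (hX p hp t ht).1) hz hw
    have hnhds : ball (0 : ℂ) 1 ∈ 𝓝 s := isOpen_ball.mem_nhds hs
    exact (differentiableAt_flow hG hX0 hX (hγ.differentiableAt hnhds)
      (eventually_of_mem hnhds hγm) ht).differentiableWithinAt
  have hzd : HasDerivWithinAt (X z) (G z) (Ici 0) 0 := by
    simpa [hX0 z hz'] using (hX z hz' 0 le_rfl).2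
  have hwd : HasDerivWithinAt (X w) (G w) (Ici 0) 0 := by
    simpa [hX0 w hw'] using (hX w hw' 0 le_rfl).2
  have hA : 0 < 1 - ‖z‖ ^ 2 := one_sub_norm_sq_pos hz
  have hB : 0 < 1 - ‖w‖ ^ 2 := one_sub_norm_sq_pos hw
  have hne := one_sub_inner_ne_zero hw hz
  have hC : 0 < ‖1 - inner ℂ w z‖ ^ 2 := pow_pos (norm_pos_iff.2 hne) 2
  have hd1 := hasDerivWithinAt_norm_sq_inner ((hasDerivWithinAt_const (0 : ℝ) (Ici 0) (1 : ℂ)).sub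
    (hwd.inner ℂ hzd))
  have hd2 := (hasDerivWithinAt_norm_sq_inner hzd).const_sub 1
  have hd3 := (hasDerivWithinAt_norm_sq_inner hwd).const_sub 1
  have hN := (hd1.mul_const ((1 - ‖z‖ ^ 2) * (1 - ‖w‖ ^ 2))).sub
    ((hd2.mul hd3).const_mul (‖1 - inner ℂ w z‖ ^ 2))
  -- The difference of the two sides of `hpick` is nonpositive and vanishes at `t = 0`.
  have hle := nonpos_of_hasDerivWithinAt_Ici hN (fun t ht => by
    have h := hpick t ht
    simp only [Pi.sub_apply, Pi.mul_apply, hX0 z hz', hX0 w hw']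
    linarith)
  simp only [Pi.sub_apply, hX0 z hz', hX0 w hw', zero_sub] at hle
  have e1 : ((inner ℂ w (G z) + inner ℂ (G w) z) / (1 - inner ℂ w z)).re =
      -(inner ℂ (1 - inner ℂ w z) (-(inner ℂ w (G z) + inner ℂ (G w) z)) : ℂ).re /
        ‖1 - inner ℂ w z‖ ^ 2 := by
    rw [Complex.div_re, ← Complex.normSq_eq_norm_sq, ← add_div]
    congr 1
    simp only [RCLike.inner_apply', Complex.mul_re, Complex.conj_re, Complex.conj_im,
      Complex.neg_re, Complex.neg_im]
    ring
  rw [e1, div_add_div _ _ hA.ne' hB.ne', div_le_div_iff₀ (mul_pos hA hB) hC]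
  nlinarith

end TwoPoint

end HolomorphicBall
end

noncomputable section

namespace HolomorphicBall

open Metric Set ComplexConjugate

/-! ### Functions with nonnegative real part on the disc. -/

section HalfPlane

/-- The Schwarz–Pick inequality for functions with positive real part on the unit disc. -/
lemma schwarz_pick_re_pos {P : ℂ → ℂ} (hP : DifferentiableOn ℂ P (ball 0 1))
    (hre : ∀ z ∈ ball (0 : ℂ) 1, 0 < (P z).re) {z w : ℂ} (hz : ‖z‖ < 1) (hw : ‖w‖ < 1) :
    ‖P z + conj (P w)‖ ^ 2 * ((1 - ‖z‖ ^ 2) * (1 - ‖w‖ ^ 2)) ≤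
      4 * (P z).re * (P w).re * ‖1 - conj w * z‖ ^ 2 := by
  have hne : ∀ z ∈ ball (0 : ℂ) 1, P z + 1 ≠ 0 := fun z hz h => by
    have h1 := congrArg Complex.re h
    have h2 := hre z hz
    simp only [Complex.add_re, Complex.one_re, Complex.zero_re] at h1
    linarith
  have hz' : z ∈ ball (0 : ℂ) 1 := by simpa using hz
  have hw' : w ∈ ball (0 : ℂ) 1 := by simpa using hw
  -- The Cayley transform carries the right half-plane to the disc.
  set f : ℂ → ℂ := fun z => (P z - 1) / (P z + 1) with hf
  have hfd : DifferentiableOn ℂ f (ball 0 1) :=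
    (hP.sub (differentiableOn_const 1)).div (hP.add (differentiableOn_const 1)) hne
  have hsq : ∀ z ∈ ball (0 : ℂ) 1, 1 - ‖f z‖ ^ 2 = 4 * (P z).re / ‖P z + 1‖ ^ 2 := by
    intro z hz
    have h1 : ‖P z + 1‖ ^ 2 ≠ 0 := pow_ne_zero 2 (norm_ne_zero_iff.2 (hne z hz))
    rw [hf, norm_div, div_pow, eq_div_iff h1, sub_mul, div_mul_cancel₀ _ h1,
      ← Complex.normSq_eq_norm_sq, ← Complex.normSq_eq_norm_sq, Complex.normSq_apply,
      Complex.normSq_apply]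
    simp only [Complex.add_re, Complex.sub_re, Complex.add_im, Complex.sub_im, Complex.one_re,
      Complex.one_im]
    ring
  have hmaps : MapsTo f (ball 0 1) (ball 0 1) := by
    intro z hz
    have h1 : 0 < ‖P z + 1‖ ^ 2 := pow_pos (norm_pos_iff.2 (hne z hz)) 2
    have h2 : 0 < 1 - ‖f z‖ ^ 2 := by
      rw [hsq z hz]
      have := hre z hz
      positivity
    rw [mem_ball_zero_iff]
    nlinarith [norm_nonneg (f z)]
  have key := schwarz_pick (f := f) (fun γ hγ hγm => hfd.comp hγ hγm) hmaps hz hw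
  have hin : (1 - inner ℂ (f w) (f z) : ℂ) =
      2 * (P z + conj (P w)) / ((P z + 1) * conj (P w + 1)) := by
    have h1 := hne z hz'
    have h2 : conj (P w + 1) ≠ 0 := (map_ne_zero _).2 (hne w hw')
    simp only [hf, RCLike.inner_apply', map_div₀, map_sub, map_add, map_one] at h2 ⊢
    field_simp
    ring
  rw [hin, hsq z hz', hsq w hw', RCLike.inner_apply', norm_div, norm_mul, norm_mul,
    Complex.norm_conj] at key
  have hp1 : 0 < ‖P z + 1‖ := norm_pos_iff.2 (hne z hz')
  have hp2 : 0 < ‖P w + 1‖ := norm_pos_iff.2 (hne w hw')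
  have h3 := mul_le_mul_of_nonneg_right key
    (by positivity : 0 ≤ (‖P z + 1‖ * ‖P w + 1‖) ^ 2 / 4)
  have e1 : (‖(2 : ℂ)‖ * ‖P z + conj (P w)‖ / (‖P z + 1‖ * ‖P w + 1‖)) ^ 2 *
      ((1 - ‖z‖ ^ 2) * (1 - ‖w‖ ^ 2)) * ((‖P z + 1‖ * ‖P w + 1‖) ^ 2 / 4) =
      ‖P z + conj (P w)‖ ^ 2 * ((1 - ‖z‖ ^ 2) * (1 - ‖w‖ ^ 2)) := by
    rw [Complex.norm_ofNat]
    field_simp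
    ring
  have e2 : ‖1 - conj w * z‖ ^ 2 *
      (4 * (P z).re / ‖P z + 1‖ ^ 2 * (4 * (P w).re / ‖P w + 1‖ ^ 2)) *
      ((‖P z + 1‖ * ‖P w + 1‖) ^ 2 / 4) =
      4 * (P z).re * (P w).re * ‖1 - conj w * z‖ ^ 2 := by
    field_simp
  rw [e1] at h3
  exact h3.trans_eq e2

/-- Apply the strict case to `Q + ε` and let `ε → 0`. -/
lemma schwarz_pick_re_nonneg {Q : ℂ → ℂ} (hQ : DifferentiableOn ℂ Q (ball 0 1))
    (hre : ∀ z ∈ ball (0 : ℂ) 1, 0 ≤ (Q z).re) {z w : ℂ} (hz : ‖z‖ < 1) (hw : ‖w‖ < 1) :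
    ‖Q z + conj (Q w)‖ ^ 2 * ((1 - ‖z‖ ^ 2) * (1 - ‖w‖ ^ 2)) ≤
      4 * (Q z).re * (Q w).re * ‖1 - conj w * z‖ ^ 2 := by
  have hε : ∀ᶠ ε : ℝ in 𝓝[>] 0,
      ‖(Q z + ε) + conj (Q w + ε)‖ ^ 2 * ((1 - ‖z‖ ^ 2) * (1 - ‖w‖ ^ 2)) ≤
      4 * (Q z + ε).re * (Q w + ε).re * ‖1 - conj w * z‖ ^ 2 := by
    filter_upwards [self_mem_nhdsWithin] with ε hε
    refine schwarz_pick_re_pos (P := fun z => Q z + ε) (hQ.add (differentiableOn_const _))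
      (fun z hz => ?_) hz hw
    have := hre z hz
    have hε' : 0 < ε := hε
    simp only [Complex.add_re, Complex.ofReal_re]
    linarith
  have hc1 : Continuous fun ε : ℝ =>
      ‖(Q z + ε) + conj (Q w + ε)‖ ^ 2 * ((1 - ‖z‖ ^ 2) * (1 - ‖w‖ ^ 2)) := by fun_prop
  have hc2 : Continuous fun ε : ℝ =>
      4 * (Q z + ε).re * (Q w + ε).re * ‖1 - conj w * z‖ ^ 2 := by fun_prop
  have := le_of_tendsto_of_tendsto ((hc1.tendsto 0).mono_left nhdsWithin_le_nhds)
    ((hc2.tendsto 0).mono_left nhdsWithin_le_nhds) hε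
  simpa using this

/-- If `Re Q ≥ 0` and `(1 - r) Re Q(r) → 0` along the radius, then `(1 - ζ) Q(ζ) → 0`
non-tangentially at `1`. -/
theorem tendsto_one_sub_mul_of_re_nonneg {Q : ℂ → ℂ} (hQ : DifferentiableOn ℂ Q (ball 0 1))
    (hre : ∀ z ∈ ball (0 : ℂ) 1, 0 ≤ (Q z).re)
    (hrad : Tendsto (fun r : ℝ => (1 - r) * (Q r).re) (𝓝[<] 1) (𝓝 0))
    {ζ : ℕ → ℂ} (hζ : ∀ k, ‖ζ k‖ < 1) (hlim : Tendsto ζ atTop (𝓝 1)) {C : ℝ} (hC : 0 < C)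
    (hnt : ∀ k, ‖ζ k - 1‖ ≤ C * (1 - ‖ζ k‖ ^ 2)) :
    Tendsto (fun k => (1 - ζ k) * Q (ζ k)) atTop (𝓝 0) := by
  have hr : Tendsto (fun k => ‖ζ k‖) atTop (𝓝[<] 1) := by
    refine tendsto_nhdsWithin_iff.2 ⟨by simpa using hlim.norm, Eventually.of_forall hζ⟩
  have hrn : ∀ k, ‖((‖ζ k‖ : ℝ) : ℂ)‖ < 1 := fun k => by simpa using hζ k
  -- radial behaviour of the modulus
  have hmod : Tendsto (fun k => (1 - ‖ζ k‖) * ‖Q (‖ζ k‖ : ℝ)‖) atTop (𝓝 0) := by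
    have h1 : Tendsto (fun k => √(4 * (Q 0).re * ((1 - ‖ζ k‖) * (Q (‖ζ k‖ : ℝ)).re)) +
        (1 - ‖ζ k‖) * ‖Q 0‖) atTop (𝓝 0) := by
      have a1 := ((hrad.comp hr).const_mul (4 * (Q 0).re)).sqrt
      have a2 : Tendsto (fun k => (1 - ‖ζ k‖) * ‖Q 0‖) atTop (𝓝 0) := by
        have : Tendsto (fun k => (1 - ‖ζ k‖) * ‖Q 0‖) atTop (𝓝 ((1 - 1) * ‖Q 0‖)) :=
          ((tendsto_nhdsWithin_iff.1 hr).1.const_sub 1).mul_const _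
        simpa using this
      simpa using a1.add a2
    refine squeeze_zero (fun k => mul_nonneg (by linarith [hζ k]) (norm_nonneg _))
      (fun k => ?_) h1
    set r := ‖ζ k‖ with hrdef
    have hr0 : 0 ≤ r := norm_nonneg _
    have hr1 : 0 < 1 - r := by linarith [hζ k]
    have hp := schwarz_pick_re_nonneg hQ hre (hrn k) (w := 0) (by simp)
    simp only [map_zero, zero_mul, sub_zero, norm_one, one_pow, mul_one, norm_zero, ne_eq,
      OfNat.ofNat_ne_zero, not_false_eq_true, zero_pow, Complex.norm_real, norm_norm] at hp
    rw [← hrdef] at hp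
    -- Comparison with the centre bounds the modulus by the square root of the real part, which
    -- controls the imaginary part as well.
    have h3 : (1 - r) * ‖Q (r : ℝ) + conj (Q 0)‖ ≤
        √(4 * (Q 0).re * ((1 - r) * (Q (r : ℝ)).re)) := by
      apply Real.le_sqrt_of_sq_le
      have h4 : 1 - r ≤ 1 - r ^ 2 := by nlinarith
      have h5 := mul_le_mul_of_nonneg_left h4 (sq_nonneg ‖Q (r : ℝ) + conj (Q 0)‖)
      have h6 := mul_le_mul_of_nonneg_left (h5.trans hp) hr1.le
      nlinarith
    have h7 : ‖Q (r : ℝ)‖ ≤ ‖Q (r : ℝ) + conj (Q 0)‖ + ‖Q 0‖ := by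
      have := norm_sub_le (Q (r : ℝ) + conj (Q 0)) (conj (Q 0))
      rwa [add_sub_cancel_right, Complex.norm_conj] at this
    nlinarith
  -- `2 * C` comes from `|1 - ζ| ≤ 2 C (1 - |ζ|)`; the other factor from comparing `Q(ζ)` with
  -- `Q(|ζ|)`.
  have hfin := hmod.const_mul (2 * C * (4 * (C + 1) ^ 2 + 1))
  rw [mul_zero] at hfin
  refine squeeze_zero_norm (fun k => ?_) hfin
  have hp := schwarz_pick_re_nonneg hQ hre (hζ k) (hrn k)
  have hre1 := hre (ζ k) (by simpa using hζ k)
  have hre2 := hre ((‖ζ k‖ : ℝ) : ℂ) (by simpa using hζ k)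
  have hn := hnt k
  simp only [Complex.norm_real, norm_norm, Complex.conj_ofReal] at hp
  have hstep : ‖1 - (‖ζ k‖ : ℂ) * ζ k‖ ≤ (C + 1) * (1 - ‖ζ k‖ ^ 2) := by
    have e1 : 1 - (‖ζ k‖ : ℂ) * ζ k = -(ζ k - 1) + ((1 - ‖ζ k‖ : ℝ) : ℂ) * ζ k := by
      push_cast; ring
    rw [e1]
    refine (norm_add_le _ _).trans ?_
    rw [norm_neg, norm_mul, Complex.norm_real, Real.norm_eq_abs, abs_of_nonneg
      (by linarith [hζ k])]
    nlinarith [norm_nonneg (ζ k), hζ k]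
  set r := ‖ζ k‖ with hrdef
  have hr0 : 0 ≤ r := norm_nonneg _
  have hr1 : 0 < 1 - r := by linarith [hζ k]
  have hd : 0 < 1 - r ^ 2 := by nlinarith
  set S := ‖Q (ζ k) + conj (Q (r : ℂ))‖ with hS
  have hS0 : 0 ≤ S := norm_nonneg _
  have hreS : (Q (ζ k)).re ≤ S := by
    have := Complex.re_le_norm (Q (ζ k) + conj (Q (r : ℂ)))
    simp only [Complex.add_re, Complex.conj_re] at this
    linarith
  have hsq : ‖1 - (r : ℂ) * ζ k‖ ^ 2 ≤ (C + 1) ^ 2 * (1 - r ^ 2) ^ 2 := by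
    rw [← mul_pow]
    exact pow_le_pow_left₀ (norm_nonneg _) hstep 2
  have hSb : S ≤ 4 * (C + 1) ^ 2 * (Q (r : ℂ)).re := by
    rcases hS0.eq_or_lt with h | h
    · rw [← h]; positivity
    · have h1 : S ^ 2 * (1 - r ^ 2) ^ 2 ≤
          4 * S * (Q (r : ℂ)).re * ((C + 1) ^ 2 * (1 - r ^ 2) ^ 2) := by
        calc S ^ 2 * (1 - r ^ 2) ^ 2 = S ^ 2 * ((1 - r ^ 2) * (1 - r ^ 2)) := by ring
          _ ≤ _ := hp
          _ ≤ _ := by gcongr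
      have h2 : S * (1 - r ^ 2) ^ 2 * S ≤ S * (1 - r ^ 2) ^ 2 *
          (4 * (C + 1) ^ 2 * (Q (r : ℂ)).re) := by linarith
      exact le_of_mul_le_mul_left h2 (by positivity)
  have hQn : ‖Q (ζ k)‖ ≤ (4 * (C + 1) ^ 2 + 1) * ‖Q (r : ℂ)‖ := by
    have h1 := norm_sub_le (Q (ζ k) + conj (Q (r : ℂ))) (conj (Q (r : ℂ)))
    rw [add_sub_cancel_right, Complex.norm_conj] at h1
    have h2 := mul_le_mul_of_nonneg_left (Complex.re_le_norm (Q (r : ℂ)))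
      (by positivity : 0 ≤ 4 * (C + 1) ^ 2)
    linarith
  have hb : ‖1 - ζ k‖ ≤ 2 * C * (1 - r) := by
    rw [norm_sub_rev]
    refine hn.trans ?_
    have : 1 - r ^ 2 ≤ 2 * (1 - r) := by nlinarith
    nlinarith
  rw [norm_mul]
  calc ‖1 - ζ k‖ * ‖Q (ζ k)‖ ≤ (2 * C * (1 - r)) * ((4 * (C + 1) ^ 2 + 1) * ‖Q (r : ℂ)‖) := by
        gcongr
    _ = _ := by ring

end HalfPlane

end HolomorphicBall
end

noncomputable section

namespace UnitBall

open Set ComplexConjugate HolomorphicBall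

variable {n : ℕ}

lemma mem_ball_iff {z : Cn n} : z ∈ ball n ↔ ‖z‖ < 1 := by simp [ball]

lemma norm_apply_le (z : Cn n) (j : Fin n) : ‖z j‖ ≤ ‖z‖ := PiLp.norm_apply_le z j

lemma e_apply (i j : Fin n) : (e i : Cn n) j = if j = i then 1 else 0 := by
  simp [e]

lemma inner_e (j : Fin n) (z : Cn n) : inner ℂ (e j : Cn n) z = z j := by
  simp [e, EuclideanSpace.inner_single_left]

lemma norm_e (j : Fin n) : ‖(e j : Cn n)‖ = 1 := by simp [e]

lemma differentiableOn_apply {G : Cn n → Cn n} (hG : DifferentiableOn ℂ G (ball n)) (j : Fin n) :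
    DifferentiableOn ℂ (fun z => G z j) (ball n) :=
  (EuclideanSpace.proj (𝕜 := ℂ) j).differentiable.comp_differentiableOn hG

variable [NeZero n]

/-! ### Poisson kernel, rate and dilation. -/

section PoissonKernel

lemma one_sub_apply_ne_zero {z : Cn n} (hz : ‖z‖ < 1) : 1 - z 0 ≠ 0 := fun h => by
  have h1 := norm_apply_le z 0
  rw [← sub_eq_zero.1 h, norm_one] at h1
  linarith

lemma poissonKernel_neg {z : Cn n} (hz : ‖z‖ < 1) : poissonKernel z < 0 := by
  have h1 := one_sub_norm_sq_pos hz
  have h2 : 0 < ‖1 - z 0‖ := norm_pos_iff.2 (one_sub_apply_ne_zero hz)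
  rw [poissonKernel, neg_lt_zero]
  positivity

lemma fderiv_poissonKernel {z : Cn n} (hz : ‖z‖ < 1) (v : Cn n) :
    fderiv ℝ (poissonKernel (n := n)) z v = poissonKernel z *
      (2 * (v 0 / (1 - z 0)).re - 2 * ((inner ℂ z v).re / (1 - ‖z‖ ^ 2))) := by
  have hne := one_sub_apply_ne_zero hz
  have hnorm : ‖1 - z 0‖ ≠ 0 := norm_ne_zero_iff.2 hne
  have hco : ∀ j : Fin n, DifferentiableAt ℝ (fun w : Cn n => w j) z := fun j =>
    ((EuclideanSpace.proj (𝕜 := ℂ) j).restrictScalars ℝ).differentiableAt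
  have hdiff : DifferentiableAt ℝ (poissonKernel (n := n)) z := by
    have h1 : DifferentiableAt ℝ (fun w : Cn n => ‖w‖ ^ 2) z := by
      simp only [EuclideanSpace.norm_sq_eq]
      exact DifferentiableAt.fun_sum fun j _ => (hco j).norm_sq ℝ
    have h2 : DifferentiableAt ℝ (fun w : Cn n => ‖1 - w 0‖ ^ 2) z :=
      ((differentiableAt_const (1 : ℂ)).sub (hco 0)).norm_sq ℝ
    unfold poissonKernel
    simp only [div_eq_mul_inv]
    exact ((h1.const_sub 1).mul (h2.inv (pow_ne_zero 2 hnorm))).neg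
  have hline : HasDerivAt (fun t : ℝ => z + t • v) v 0 := by
    simpa using ((hasDerivAt_id (0 : ℝ)).smul_const v).const_add z
  have hd1 := hdiff.hasFDerivAt.comp_hasDerivAt_of_eq (0 : ℝ) hline (by simp)
  have hl0 : HasDerivAt (fun t : ℝ => 1 - (z + t • v) 0) (-v 0) 0 := by
    have := ((((EuclideanSpace.proj (𝕜 := ℂ) (0 : Fin n)).restrictScalars ℝ).hasFDerivAt
      (x := z + (0 : ℝ) • v)).comp_hasDerivAt (0 : ℝ) hline).const_sub (1 : ℂ)
    simpa using this
  have hn1 := (hasDerivWithinAt_norm_sq_inner (s := univ) hline.hasDerivWithinAt).hasDerivAt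
    univ_mem
  have hn2 := (hasDerivWithinAt_norm_sq_inner (s := univ) hl0.hasDerivWithinAt).hasDerivAt
    univ_mem
  have hd2 := ((hn1.const_sub 1).div hn2 (by simpa using hnorm)).neg
  have huniq := hd1.unique hd2
  rw [huniq]
  have e1 : (inner ℂ (1 - z 0) (-v 0) : ℂ).re = -((v 0 / (1 - z 0)).re * ‖1 - z 0‖ ^ 2) := by
    have h1 : v 0 / (1 - z 0) * ((‖1 - z 0‖ ^ 2 : ℝ) : ℂ) = v 0 * conj (1 - z 0) := by
      push_cast
      rw [← Complex.mul_conj' (1 - z 0)]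
      field_simp
    rw [← Complex.re_mul_ofReal, h1, RCLike.inner_apply']
    simp only [Complex.mul_re, Complex.conj_re, Complex.conj_im, Complex.neg_re, Complex.neg_im]
    ring
  have h0 : (z + (0 : ℝ) • v) = z := by simp
  simp only [h0, e1, poissonKernel]
  have hz1 := (one_sub_norm_sq_pos hz).ne'
  field_simp
  ring

/-- Minus the logarithmic derivative of the Poisson kernel along `G`; the dilation is its
supremum over the ball. -/
def rate (G : Cn n → Cn n) (z : Cn n) : ℝ :=
  2 * ((inner ℂ z (G z)).re / (1 - ‖z‖ ^ 2) - (G z 0 / (1 - z 0)).re)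

lemma fderiv_poissonKernel_div {G : Cn n → Cn n} {z : Cn n} (hz : ‖z‖ < 1) :
    fderiv ℝ (poissonKernel (n := n)) z (G z) / poissonKernel z = -rate G z := by
  rw [fderiv_poissonKernel hz, mul_div_cancel_left₀ _ (poissonKernel_neg hz).ne, rate]
  ring

lemma isBRNP_of_rate_le {G : Cn n → Cn n} {b : ℝ} (h : ∀ z ∈ ball n, rate G z ≤ b) :
    IsBRNP G := by
  refine ⟨b, fun z hz => ?_⟩
  have hz' := mem_ball_iff.1 hz
  have h1 := poissonKernel_neg hz'
  have h2 := (div_eq_iff h1.ne).1 (fderiv_poissonKernel_div (G := G) hz')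
  rw [h2]
  nlinarith [h z hz]

lemma rate_le_dilation {G : Cn n → Cn n} {b : ℝ} (h : ∀ z ∈ ball n, rate G z ≤ b)
    {z : Cn n} (hz : z ∈ ball n) : rate G z ≤ dilation G := by
  rw [dilation, le_neg, ← fderiv_poissonKernel_div (mem_ball_iff.1 hz)]
  refine csInf_le ⟨-b, ?_⟩ (mem_image_of_mem _ hz)
  rintro _ ⟨w, hw, rfl⟩
  simp only [fderiv_poissonKernel_div (mem_ball_iff.1 hw)]
  exact neg_le_neg (h w hw)

lemma exists_lt_rate {G : Cn n → Cn n} {c : ℝ} (hc : c < dilation G) :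
    ∃ z ∈ ball n, c < rate G z := by
  rw [dilation, lt_neg] at hc
  obtain ⟨_, ⟨z, hz, rfl⟩, h⟩ := exists_lt_of_csInf_lt
    (Set.Nonempty.image _ ⟨0, by simp [ball]⟩) hc
  simp only [fderiv_poissonKernel_div (mem_ball_iff.1 hz)] at h
  exact ⟨z, hz, by linarith⟩

end PoissonKernel

/-! ### The two-point inequality as the second point tends radially to the vertex. -/

section Radial

/-- The normal component divided by `z₁ - 1`. -/
def normalQuotient (G : Cn n → Cn n) (z : Cn n) : ℂ := G z 0 / (z 0 - 1)

lemma smul_e_apply_zero (a : ℂ) : (a • (e 0 : Cn n)) 0 = a := by simp [e_apply]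

lemma norm_smul_e (a : ℂ) : ‖a • (e 0 : Cn n)‖ = ‖a‖ := by rw [norm_smul, norm_e, mul_one]

lemma radius_mem_koranyi {r : ℝ} (h0 : 0 ≤ r) (h1 : r < 1) :
    (r : ℂ) • (e 0 : Cn n) ∈ koranyi n 2 := by
  have hr : ‖(r : ℂ)‖ = r := by rw [Complex.norm_real, Real.norm_of_nonneg h0]
  refine ⟨mem_ball_iff.2 (by rw [norm_smul_e, hr]; exact h1), ?_⟩
  rw [smul_e_apply_zero, norm_smul_e, hr]
  have : ‖(1 - r : ℂ)‖ = 1 - r := by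
    rw [show (1 - r : ℂ) = ((1 - r : ℝ) : ℂ) by push_cast; ring, Complex.norm_real,
      Real.norm_of_nonneg (by linarith)]
  rw [this]
  nlinarith

lemma eventually_radius : ∀ᶠ r : ℝ in 𝓝[<] 1, 0 < r ∧ r < 1 :=
  Ioo_mem_nhdsLT one_pos

variable {G : Cn n → Cn n}

lemma tendsto_radius_apply
    (h₁ : BoundedInKoranyi (fun z : Cn n => ‖G z 0‖ / ‖z 0 - 1‖))
    (h₂ : ∀ j : Fin n, j ≠ 0 →
      BoundedInKoranyi (fun z : Cn n => ‖G z j‖ / ‖z 0 - 1‖ ^ (1 / 2 : ℝ))) (j : Fin n) :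
    Tendsto (fun r : ℝ => G ((r : ℂ) • (e 0 : Cn n)) j) (𝓝[<] 1) (𝓝 0) := by
  have hnorm : ∀ r : ℝ, r < 1 → ‖((r : ℂ) • (e 0 : Cn n)) 0 - 1‖ = 1 - r := fun r hr => by
    rw [smul_e_apply_zero, show (r - 1 : ℂ) = ((r - 1 : ℝ) : ℂ) by push_cast; ring,
      Complex.norm_real, Real.norm_eq_abs, abs_of_neg (by linarith)]
    ring
  by_cases hj : j = 0
  · subst hj
    obtain ⟨C, hC⟩ := h₁ 2 one_le_two
    have hlim : Tendsto (fun r : ℝ => C * (1 - r)) (𝓝[<] 1) (𝓝 0) := by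
      have : Continuous fun r : ℝ => C * (1 - r) := by fun_prop
      simpa using (this.tendsto 1).mono_left nhdsWithin_le_nhds
    refine squeeze_zero_norm' ?_ hlim
    filter_upwards [eventually_radius] with r hr
    have h := hC _ (radius_mem_koranyi hr.1.le hr.2)
    rw [norm_div, norm_norm, norm_norm, hnorm r hr.2, div_le_iff₀ (by linarith [hr.2])] at h
    exact h
  · obtain ⟨C, hC⟩ := h₂ j hj 2 one_le_two
    have hlim : Tendsto (fun r : ℝ => C * (1 - r) ^ (1 / 2 : ℝ)) (𝓝[<] 1) (𝓝 0) := by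
      have h1 : Continuous fun r : ℝ => C * (1 - r) ^ (1 / 2 : ℝ) :=
        continuous_const.mul ((continuous_const.sub continuous_id).rpow_const
          fun _ => Or.inr (by norm_num))
      simpa using (h1.tendsto 1).mono_left nhdsWithin_le_nhds
    refine squeeze_zero_norm' ?_ hlim
    filter_upwards [eventually_radius] with r hr
    have h := hC _ (radius_mem_koranyi hr.1.le hr.2)
    have hpos : 0 < 1 - r := by linarith [hr.2]
    beta_reduce at h
    rw [hnorm r hr.2, norm_div, norm_norm, Real.norm_of_nonneg (by positivity),
      div_le_iff₀ (by positivity)] at h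
    exact h

lemma tendsto_two_point_radius
    (hlim : ∀ j, Tendsto (fun r : ℝ => G ((r : ℂ) • (e 0 : Cn n)) j) (𝓝[<] 1) (𝓝 0))
    {z : Cn n} (hz : ‖z‖ < 1) :
    Tendsto (fun r : ℝ => 2 * ((inner ℂ z (G z)).re / (1 - ‖z‖ ^ 2) -
      ((r * G z 0 + inner ℂ (G ((r : ℂ) • (e 0 : Cn n))) z) / (1 - r * z 0)).re))
      (𝓝[<] 1) (𝓝 (rate G z)) := by
  have hin : Tendsto (fun r : ℝ => (inner ℂ (G ((r : ℂ) • (e 0 : Cn n))) z : ℂ))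
      (𝓝[<] 1) (𝓝 0) := by
    simp only [PiLp.inner_apply, RCLike.inner_apply']
    have := tendsto_finsetSum (Finset.univ : Finset (Fin n)) fun j _ =>
      ((Complex.continuous_conj.tendsto _).comp (hlim j)).mul_const (z j)
    simpa using this
  have hr : Tendsto (fun r : ℝ => (r : ℂ)) (𝓝[<] 1) (𝓝 1) := by
    simpa using (Complex.continuous_ofReal.tendsto 1).mono_left nhdsWithin_le_nhds
  have h1 := ((hr.mul_const (G z 0)).add hin).div ((hr.mul_const (z 0)).const_sub 1)
    (by simpa using one_sub_apply_ne_zero hz)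
  have h2 := (((Complex.continuous_re.tendsto _).comp h1).const_sub
    ((inner ℂ z (G z)).re / (1 - ‖z‖ ^ 2))).const_mul 2
  simpa [rate] using h2

/-- At the point `r e₁`, the factor `1 - r²` cancels against `r - 1`, leaving `r / (1 + r)` times
the real part of the quotient. -/
lemma two_point_radius (hG : IsInfinitesimalGenerator G) {z : Cn n} (hz : ‖z‖ < 1) {r : ℝ}
    (h0 : 0 < r) (h1 : r < 1) :
    2 * ((inner ℂ z (G z)).re / (1 - ‖z‖ ^ 2) -
      ((r * G z 0 + inner ℂ (G ((r : ℂ) • (e 0 : Cn n))) z) / (1 - r * z 0)).re) ≤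
      2 * r / (1 + r) * (normalQuotient G ((r : ℂ) • (e 0 : Cn n))).re := by
  have hr : ‖(r : ℂ)‖ = r := by rw [Complex.norm_real, Real.norm_of_nonneg h0.le]
  have key := generator_two_point (E := Cn n) (G := G) hG.1
    (fun z hz => hG.2 z hz) hz (w := (r : ℂ) • (e 0 : Cn n)) (by rw [norm_smul_e, hr]; exact h1)
  rw [norm_smul_e, hr] at key
  simp only [inner_smul_left, inner_e, Complex.conj_ofReal] at key
  have e1 : ((r : ℂ) * G ((r : ℂ) • (e 0 : Cn n)) 0).re / (1 - r ^ 2) =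
      -(r / (1 + r) * (normalQuotient G ((r : ℂ) • (e 0 : Cn n))).re) := by
    rw [normalQuotient, smul_e_apply_zero,
      show (r - 1 : ℂ) = ((r - 1 : ℝ) : ℂ) by push_cast; ring, Complex.div_ofReal_re,
      Complex.re_ofReal_mul]
    have a1 : r - 1 ≠ 0 := by linarith
    have a2 : 1 + r ≠ 0 := by linarith
    have a3 : 1 - r ^ 2 ≠ 0 := by nlinarith
    field_simp
    ring
  rw [e1] at key
  have e2 : 2 * r / (1 + r) * (normalQuotient G ((r : ℂ) • (e 0 : Cn n))).re =
      2 * (r / (1 + r) * (normalQuotient G ((r : ℂ) • (e 0 : Cn n))).re) := by ring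
  rw [e2]
  linarith

lemma exists_radius_bound
    (h₁ : BoundedInKoranyi (fun z : Cn n => ‖G z 0‖ / ‖z 0 - 1‖)) :
    ∃ C : ℝ, 0 ≤ C ∧ ∀ r : ℝ, 0 < r → r < 1 →
      |(normalQuotient G ((r : ℂ) • (e 0 : Cn n))).re| ≤ C := by
  obtain ⟨C, hC⟩ := h₁ 2 one_le_two
  have hb : ∀ r : ℝ, 0 < r → r < 1 →
      |(normalQuotient G ((r : ℂ) • (e 0 : Cn n))).re| ≤ C := fun r h0 h1 => by
    refine (Complex.abs_re_le_norm _).trans ?_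
    have := hC _ (radius_mem_koranyi h0.le h1)
    rwa [norm_div, norm_norm, norm_norm, ← norm_div] at this
  exact ⟨C, (abs_nonneg _).trans (hb (1 / 2) (by norm_num) (by norm_num)), hb⟩

/-- The rate is bounded above, so that the boundary point is a regular null point. -/
lemma exists_rate_le (hG : IsInfinitesimalGenerator G)
    (h₁ : BoundedInKoranyi (fun z : Cn n => ‖G z 0‖ / ‖z 0 - 1‖))
    (h₂ : ∀ j : Fin n, j ≠ 0 →
      BoundedInKoranyi (fun z : Cn n => ‖G z j‖ / ‖z 0 - 1‖ ^ (1 / 2 : ℝ))) :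
    ∃ b : ℝ, ∀ z ∈ ball n, rate G z ≤ b := by
  obtain ⟨C, hC0, hC⟩ := exists_radius_bound h₁
  refine ⟨C, fun z hz => ?_⟩
  have hz' := mem_ball_iff.1 hz
  refine le_of_tendsto (tendsto_two_point_radius (tendsto_radius_apply h₁ h₂) hz') ?_
  filter_upwards [eventually_radius] with r hr
  refine (two_point_radius hG hz' hr.1 hr.2).trans ?_
  have h1 := (le_abs_self _).trans (hC r hr.1 hr.2)
  have h2 : 0 < 2 * r / (1 + r) := by have := hr.1; positivity
  have h3 : 2 * r / (1 + r) ≤ 1 := by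
    rw [div_le_one (by linarith [hr.1])]; linarith [hr.2]
  nlinarith

/-- A single point where `rate` exceeds `c` suffices: the two-point inequality transfers its rate to
the radius, because `2 r / (1 + r) → 1` and the quotient is bounded there. -/
lemma eventually_lt_re_normalQuotient (hG : IsInfinitesimalGenerator G)
    (h₁ : BoundedInKoranyi (fun z : Cn n => ‖G z 0‖ / ‖z 0 - 1‖))
    (h₂ : ∀ j : Fin n, j ≠ 0 →
      BoundedInKoranyi (fun z : Cn n => ‖G z j‖ / ‖z 0 - 1‖ ^ (1 / 2 : ℝ)))
    {c : ℝ} (hc : c < dilation G) :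
    ∀ᶠ r : ℝ in 𝓝[<] 1, c < (normalQuotient G ((r : ℂ) • (e 0 : Cn n))).re := by
  obtain ⟨C, hC0, hC⟩ := exists_radius_bound h₁
  obtain ⟨d, hcd, hd⟩ := exists_between hc
  obtain ⟨z, hz, hzd⟩ := exists_lt_rate hd
  have hz' := mem_ball_iff.1 hz
  have hev := (tendsto_two_point_radius (tendsto_radius_apply h₁ h₂) hz').eventually
    (lt_mem_nhds hzd)
  have hsm : ∀ᶠ r : ℝ in 𝓝[<] 1, C * (1 - r) < d - c := by
    have h : Continuous fun r : ℝ => C * (1 - r) := by fun_prop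
    have h2 : Tendsto (fun r : ℝ => C * (1 - r)) (𝓝[<] 1) (𝓝 0) := by
      simpa using (h.tendsto 1).mono_left nhdsWithin_le_nhds
    exact h2.eventually (gt_mem_nhds (sub_pos.2 hcd))
  filter_upwards [hev, hsm, eventually_radius] with r h3 h4 h5
  have h6 := h3.trans_le (two_point_radius hG hz' h5.1 h5.2)
  have h7 := neg_le_of_abs_le (hC r h5.1 h5.2)
  set q := (normalQuotient G ((r : ℂ) • (e 0 : Cn n))).re
  have hpos : 0 < 1 + r := by linarith [h5.1]
  rw [div_mul_eq_mul_div, lt_div_iff₀ hpos] at h6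
  -- If `q ≤ c`, then `d (1 + r) < 2 r q = (1 + r) q - (1 - r) q ≤ (1 + r) c + (1 - r) C`, against
  -- `C (1 - r) < d - c`.
  by_contra! hq
  nlinarith [h5.1, h5.2]

end Radial

end UnitBall
end

noncomputable section

namespace UnitBall

open Set ComplexConjugate HolomorphicBall

variable {n : ℕ} [NeZero n]

/-! ### Non-tangential limit along the slice through the vertex. -/

section Slice

variable {G : Cn n → Cn n}

lemma sub_one_ne_zero {z : Cn n} (hz : z ∈ ball n) : z 0 - 1 ≠ 0 := by
  rw [← neg_sub]
  exact neg_ne_zero.2 (one_sub_apply_ne_zero (mem_ball_iff.1 hz))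

lemma differentiableOn_normalQuotient (hG : DifferentiableOn ℂ G (ball n)) :
    DifferentiableOn ℂ (normalQuotient G) (ball n) := by
  intro z hz
  have h0 : DifferentiableWithinAt ℂ (fun z : Cn n => z 0 - 1) (ball n) z :=
    ((EuclideanSpace.proj (𝕜 := ℂ) (0 : Fin n)).differentiableAt.sub_const 1).differentiableWithinAt
  unfold normalQuotient
  simp only [div_eq_mul_inv]
  exact (differentiableOn_apply hG 0 z hz).mul (h0.inv (sub_one_ne_zero hz))

/-- The normalized function of nonnegative real part attached to the slice of `G`. -/
def sliceQ (G : Cn n → Cn n) (ζ : ℂ) : ℂ :=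
  (dilation G - normalQuotient G (ζ • (e 0 : Cn n))) / (1 - ζ) - dilation G / 2

lemma slice_mem_ball {ζ : ℂ} (h : ‖ζ‖ < 1) : ζ • (e 0 : Cn n) ∈ ball n :=
  mem_ball_iff.2 (by rwa [norm_smul_e])

lemma differentiableOn_sliceQ (hG : DifferentiableOn ℂ G (ball n)) :
    DifferentiableOn ℂ (sliceQ G) (Metric.ball 0 1) := by
  have h1 : DifferentiableOn ℂ (fun ζ : ℂ => normalQuotient G (ζ • (e 0 : Cn n)))
      (Metric.ball 0 1) :=
    (differentiableOn_normalQuotient hG).comp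
      (differentiable_id.smul_const (e 0 : Cn n)).differentiableOn
      fun ζ hζ => slice_mem_ball (by simpa using hζ)
  refine ((h1.const_sub _).div (differentiableOn_id.const_sub 1) fun ζ hζ h => ?_).sub_const _
  have : ‖ζ‖ < 1 := by simpa using hζ
  rw [← show (1 : ℂ) = ζ from sub_eq_zero.1 h, norm_one] at this
  exact lt_irrefl _ this

/-- With `g = G₁(ζ e₁)`, the part of `sliceQ` involving `G` is `g / (1 - ζ)²`, whose real part is
`-rate / 2` times the disc Poisson kernel. The shift by `β / 2` is what makes the remaining part, `β
(1 / (1 - ζ) - 1 / 2)`, have real part `β / 2` times the same kernel. -/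
lemma re_sliceQ {ζ : ℂ} (hζ : ‖ζ‖ < 1) :
    (sliceQ G ζ).re = (dilation G - rate G (ζ • (e 0 : Cn n))) / 2 *
      ((1 - ‖ζ‖ ^ 2) / ‖1 - ζ‖ ^ 2) := by
  have hne : 1 - ζ ≠ 0 := fun h => by
    rw [← sub_eq_zero.1 h, norm_one] at hζ
    exact lt_irrefl _ hζ
  have hne' : ζ - 1 ≠ 0 := by rw [← neg_sub]; exact neg_ne_zero.2 hne
  have hcne : 1 - conj ζ ≠ 0 := by
    rw [show 1 - conj ζ = conj (1 - ζ) by simp]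
    exact (map_ne_zero _).2 hne
  have hd := one_sub_norm_sq_pos hζ
  have hdc : (1 - ζ * conj ζ) ≠ 0 := by
    rw [Complex.mul_conj']
    exact_mod_cast hd.ne'
  have hn2 : ((‖1 - ζ‖ ^ 2 : ℝ) : ℂ) = (1 - ζ) * (1 - conj ζ) := by
    push_cast
    rw [← Complex.mul_conj']
    simp
  have hz2 : ((1 - ‖ζ‖ ^ 2 : ℝ) : ℂ) = 1 - ζ * conj ζ := by
    push_cast
    rw [← Complex.mul_conj']
  set g := G (ζ • (e 0 : Cn n)) 0 with hg
  have hrate : rate G (ζ • (e 0 : Cn n)) =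
      (2 * (conj ζ * g / ((1 - ‖ζ‖ ^ 2 : ℝ) : ℂ) - g / (1 - ζ))).re := by
    rw [rate, norm_smul_e, smul_e_apply_zero, inner_smul_left, inner_e, ← hg,
      show (2 : ℂ) = ((2 : ℝ) : ℂ) by norm_num, Complex.re_ofReal_mul, Complex.sub_re,
      Complex.div_ofReal_re]
  have hhalf : (1 / (1 - ζ) - 1 / 2).re = (1 - ‖ζ‖ ^ 2) / ‖1 - ζ‖ ^ 2 / 2 := by
    have e1 : ((1 / (1 - ζ) - 1 / 2) + conj (1 / (1 - ζ) - 1 / 2)) =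
        ((((1 - ‖ζ‖ ^ 2) / ‖1 - ζ‖ ^ 2 : ℝ)) : ℂ) := by
      rw [Complex.ofReal_div, hn2, hz2]
      simp only [map_sub, map_div₀, map_one, Complex.conj_ofNat]
      field_simp
      ring
    have e2 := congrArg Complex.re e1
    rw [Complex.add_re, Complex.conj_re, Complex.ofReal_re] at e2
    linarith
  have hsplit : sliceQ G ζ = ((dilation G : ℝ) : ℂ) * (1 / (1 - ζ) - 1 / 2) +
      (((-((1 - ‖ζ‖ ^ 2) / ‖1 - ζ‖ ^ 2) / 2 : ℝ)) : ℂ) *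
        (2 * (conj ζ * g / ((1 - ‖ζ‖ ^ 2 : ℝ) : ℂ) - g / (1 - ζ))) := by
    rw [sliceQ, normalQuotient, smul_e_apply_zero, ← hg, Complex.ofReal_div, Complex.ofReal_neg,
      Complex.ofReal_div, hn2, hz2, Complex.ofReal_ofNat, ← neg_sub 1 ζ]
    field_simp
    ring
  rw [hsplit, Complex.add_re, Complex.re_ofReal_mul, Complex.re_ofReal_mul, ← hrate, hhalf]
  ring

theorem tendsto_normalQuotient_slice (hG : IsInfinitesimalGenerator G)
    (h₁ : BoundedInKoranyi (fun z : Cn n => ‖G z 0‖ / ‖z 0 - 1‖))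
    (h₂ : ∀ j : Fin n, j ≠ 0 →
      BoundedInKoranyi (fun z : Cn n => ‖G z j‖ / ‖z 0 - 1‖ ^ (1 / 2 : ℝ)))
    {ζ : ℕ → ℂ} (hζ : ∀ k, ‖ζ k‖ < 1) (hlim : Tendsto ζ atTop (𝓝 1)) {C : ℝ} (hC : 0 < C)
    (hnt : ∀ k, ‖ζ k - 1‖ ≤ C * (1 - ‖ζ k‖ ^ 2)) :
    Tendsto (fun k => normalQuotient G (ζ k • (e 0 : Cn n))) atTop (𝓝 (dilation G : ℂ)) := by
  obtain ⟨b, hb⟩ := exists_rate_le hG h₁ h₂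
  have hre : ∀ z ∈ Metric.ball (0 : ℂ) 1, 0 ≤ (sliceQ G z).re := fun z hz => by
    have hz' : ‖z‖ < 1 := by simpa using hz
    rw [re_sliceQ hz']
    have h1 := rate_le_dilation hb (slice_mem_ball (n := n) hz')
    have h2 := one_sub_norm_sq_pos hz'
    have h3 : 0 ≤ dilation G - rate G (z • (e 0 : Cn n)) := by linarith
    positivity
  have hval : ∀ r : ℝ, r < 1 → (1 - r) * (sliceQ G r).re =
      dilation G - (normalQuotient G ((r : ℂ) • (e 0 : Cn n))).re - dilation G / 2 * (1 - r) := by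
    intro r hr
    have h1 : (1 - r : ℝ) ≠ 0 := by linarith
    rw [sliceQ, show (1 - (r : ℂ)) = ((1 - r : ℝ) : ℂ) by push_cast; ring,
      show (dilation G / 2 : ℂ) = ((dilation G / 2 : ℝ) : ℂ) by push_cast; ring, Complex.sub_re,
      Complex.div_ofReal_re, Complex.sub_re, Complex.ofReal_re, Complex.ofReal_re]
    field_simp
  -- Nonnegativity of `Re Q` bounds this below, the radial lower estimate for `Re q` bounds it
  -- above.
  have hrad : Tendsto (fun r : ℝ => (1 - r) * (sliceQ G r).re) (𝓝[<] 1) (𝓝 0) := by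
    rw [Metric.tendsto_nhds]
    intro ε hε
    have hsm : ∀ᶠ r : ℝ in 𝓝[<] 1, -(dilation G / 2 * (1 - r)) < ε / 2 := by
      have h : Continuous fun r : ℝ => -(dilation G / 2 * (1 - r)) := by fun_prop
      have h2 : Tendsto (fun r : ℝ => -(dilation G / 2 * (1 - r))) (𝓝[<] 1) (𝓝 0) := by
        simpa using (h.tendsto 1).mono_left nhdsWithin_le_nhds
      exact h2.eventually (gt_mem_nhds (half_pos hε))
    filter_upwards [hsm, eventually_radius, eventually_lt_re_normalQuotient hG h₁ h₂
      (c := dilation G - ε / 2) (by linarith)] with r h3 h4 h5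
    have h6 : 0 ≤ (sliceQ G r).re := hre r (by
      simpa [abs_of_pos h4.1] using h4.2)
    rw [dist_zero_right, Real.norm_of_nonneg (mul_nonneg (by linarith) h6), hval r h4.2]
    linarith
  have hQ := tendsto_one_sub_mul_of_re_nonneg (differentiableOn_sliceQ hG.1) hre hrad hζ hlim hC hnt
  have h7 : Tendsto (fun k => (dilation G : ℂ) - (1 - ζ k) * sliceQ G (ζ k) -
      (1 - ζ k) * (dilation G / 2)) atTop (𝓝 ((dilation G : ℂ) - 0 - (1 - 1) * (dilation G / 2))) :=
    (hQ.const_sub _).sub ((hlim.const_sub 1).mul_const _)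
  simp only [sub_self, zero_mul, sub_zero] at h7
  refine h7.congr fun k => ?_
  have hne : 1 - ζ k ≠ 0 := fun h => by
    have := hζ k
    rw [← sub_eq_zero.1 h, norm_one] at this
    exact lt_irrefl _ this
  rw [sliceQ]
  field_simp
  ring

end Slice

end UnitBall
end

/-! ### Cauchy estimates for directional derivatives. -/

noncomputable section

namespace UnitBall

open Set ComplexConjugate HolomorphicBall

variable {n : ℕ}

/-- Cauchy estimate for a directional derivative. -/
lemma norm_fderiv_apply_le {F : Cn n → ℂ} (hF : DifferentiableOn ℂ F (ball n)) {z v : Cn n}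
    {ρ M : ℝ} (hρ : 0 < ρ) (hmem : ∀ l : ℂ, ‖l‖ ≤ ρ → z + l • v ∈ ball n)
    (hM : ∀ l : ℂ, ‖l‖ ≤ ρ → ‖F (z + l • v)‖ ≤ M) : ‖fderiv ℂ F z v‖ ≤ M / ρ := by
  have hz : z ∈ ball n := by simpa using hmem 0 (by simpa using hρ.le)
  have hline : ∀ a : ℂ, HasDerivAt (fun l : ℂ => z + l • v) v a := fun a => by
    simpa using ((hasDerivAt_id a).smul_const v).const_add z
  have hFz : HasFDerivAt F (fderiv ℂ F z) z :=
    (hF.differentiableAt (Metric.isOpen_ball.mem_nhds hz)).hasFDerivAt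
  have hd := hFz.comp_hasDerivAt_of_eq (0 : ℂ) (hline 0) (by simp)
  rw [← hd.deriv]
  refine Complex.norm_deriv_le_of_forall_mem_sphere_norm_le hρ
    (DifferentiableOn.diffContOnCl_ball (U := Metric.closedBall 0 ρ) ?_ le_rfl) fun l hl => ?_
  · exact hF.comp (fun l _ => (hline l).differentiableAt.differentiableWithinAt)
      fun l hl => hmem l (by simpa using hl)
  · exact hM l (by simpa using (mem_sphere_iff_norm.1 hl).le)

lemma fderiv_apply_eq {G : Cn n → Cn n} (hG : DifferentiableOn ℂ G (ball n)) {z : Cn n}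
    (hz : z ∈ ball n) (v : Cn n) (k : Fin n) :
    fderiv ℂ (fun z => G z k) z v = fderiv ℂ G z v k := by
  have hGz : HasFDerivAt G (fderiv ℂ G z) z :=
    (hG.differentiableAt (Metric.isOpen_ball.mem_nhds hz)).hasFDerivAt
  have := ((EuclideanSpace.proj (𝕜 := ℂ) k).hasFDerivAt (x := G z)).comp z hGz
  rw [HasFDerivAt.fderiv (f := fun z => G z k) this]
  simp

variable [NeZero n]

/-! ### Geometry of Korányi regions. -/

section Geometry

lemma norm_sq_eq_slice_add (z : Cn n) :
    ‖z‖ ^ 2 = ‖z 0‖ ^ 2 + ‖z - z 0 • (e 0 : Cn n)‖ ^ 2 := by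
  have h0 : inner ℂ (z 0 • (e 0 : Cn n)) (z - z 0 • (e 0 : Cn n)) = 0 := by
    rw [inner_smul_left, inner_e]
    simp [e_apply]
  have := norm_add_sq (𝕜 := ℂ) (z 0 • (e 0 : Cn n)) (z - z 0 • (e 0 : Cn n))
  rw [h0, add_sub_cancel, norm_smul_e] at this
  simpa using this

lemma norm_apply_sq_le {z : Cn n} (hz : ‖z‖ < 1) {j : Fin n} (hj : j ≠ 0) :
    ‖z j‖ ^ 2 ≤ 2 * ‖1 - z 0‖ := by
  have h1 : ‖z j‖ ≤ ‖z - z 0 • (e 0 : Cn n)‖ := by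
    have := norm_apply_le (z - z 0 • (e 0 : Cn n)) j
    simpa [e_apply, hj] using this
  have h2 := norm_sq_eq_slice_add z
  have h3 := pow_le_pow_left₀ (norm_nonneg _) h1 2
  have h4 : 1 - ‖z 0‖ ≤ ‖1 - z 0‖ := by
    simpa using norm_sub_norm_le (1 : ℂ) (z 0)
  nlinarith [norm_nonneg z, norm_nonneg (z 0), norm_apply_le z 0]

lemma koranyi_pos {R : ℝ} {z : Cn n} (hz : z ∈ koranyi n R) : 0 < ‖1 - z 0‖ :=
  norm_pos_iff.2 (one_sub_apply_ne_zero (mem_ball_iff.1 hz.1))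

/-- Korányi regions are stable under moves of size comparable to `|1 - z₁|` in the normal
direction. -/
lemma koranyi_add_normal {R : ℝ} (hR : 1 ≤ R) {z : Cn n} (hz : z ∈ koranyi n R) {l : ℂ}
    (hl : ‖l‖ ≤ 1 / (8 * R) * ‖1 - z 0‖) :
    z + l • (e 0 : Cn n) ∈ koranyi n (4 * R) ∧
      ‖1 - (z + l • (e 0 : Cn n)) 0‖ ≤ 2 * ‖1 - z 0‖ := by
  have hz1 := mem_ball_iff.1 hz.1
  have hpos := one_sub_norm_sq_pos hz1
  have hK := hz.2
  have hRl : R * ‖l‖ ≤ ‖1 - z 0‖ / 8 := by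
    rw [div_mul_eq_mul_div, one_mul, le_div_iff₀ (by positivity)] at hl
    linarith
  -- The move is small relative to `1 - ‖z‖²`, which is at most halved while `|1 - z₁|` at most
  -- doubles: hence `4 * R`.
  have hl1 : ‖l‖ ≤ (1 - ‖z‖ ^ 2) / 16 := by
    have : R * ‖l‖ ≤ R * ((1 - ‖z‖ ^ 2) / 16) := by linarith
    exact le_of_mul_le_mul_left this (by linarith)
  have hl2 : ‖l‖ ≤ ‖1 - z 0‖ / 8 := by nlinarith [norm_nonneg l]
  have hn : ‖z + l • (e 0 : Cn n)‖ ≤ ‖z‖ + ‖l‖ := by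
    have := norm_add_le z (l • (e 0 : Cn n))
    rwa [norm_smul_e] at this
  have hsq := pow_le_pow_left₀ (norm_nonneg _) hn 2
  have hl0 := norm_nonneg l
  have hz0 := norm_nonneg z
  have hhalf : (1 - ‖z‖ ^ 2) / 2 ≤ 1 - ‖z + l • (e 0 : Cn n)‖ ^ 2 := by nlinarith
  have he : 1 - (z + l • (e 0 : Cn n)) 0 = (1 - z 0) - l := by simp [e_apply]; ring
  have hup : ‖1 - (z + l • (e 0 : Cn n)) 0‖ ≤ 2 * ‖1 - z 0‖ := by
    rw [he]
    linarith [norm_sub_le (1 - z 0) l, norm_nonneg (1 - z 0)]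
  refine ⟨⟨mem_ball_iff.2 (by nlinarith [norm_nonneg (z + l • (e 0 : Cn n))]), ?_⟩, hup⟩
  have := mul_le_mul_of_nonneg_left hhalf (by linarith : 0 ≤ R)
  linarith

/-- Korányi regions are stable under moves of size comparable to `|1 - z₁| ^ (1 / 2)` in the
tangential directions. -/
lemma koranyi_add_tangent {R : ℝ} (hR : 1 ≤ R) {z : Cn n} (hz : z ∈ koranyi n R) {j : Fin n}
    (hj : j ≠ 0) {l : ℂ} (hl : ‖l‖ ≤ 1 / (8 * R) * ‖1 - z 0‖ ^ (1 / 2 : ℝ)) :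
    z + l • (e j : Cn n) ∈ koranyi n (4 * R) ∧ (z + l • (e j : Cn n)) 0 = z 0 := by
  have hz1 := mem_ball_iff.1 hz.1
  have hpos := one_sub_norm_sq_pos hz1
  have hK := hz.2
  rw [← Real.sqrt_eq_rpow] at hl
  set s := √‖1 - z 0‖ with hs
  have hs0 : 0 ≤ s := Real.sqrt_nonneg _
  have hs2 : s ^ 2 = ‖1 - z 0‖ := Real.sq_sqrt (norm_nonneg _)
  have hRl : R * ‖l‖ ≤ s / 8 := by
    rw [div_mul_eq_mul_div, one_mul, le_div_iff₀ (by positivity)] at hl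
    linarith
  have hl0 := norm_nonneg l
  have hzj : ‖z j‖ ≤ 2 * s := by
    have := norm_apply_sq_le hz1 hj
    rw [← hs2] at this
    nlinarith [norm_nonneg (z j)]
  have he : (z + l • (e j : Cn n)) 0 = z 0 := by simp [e_apply, hj.symm]
  have hn : ‖z + l • (e j : Cn n)‖ ^ 2 ≤ ‖z‖ ^ 2 + 2 * (‖l‖ * ‖z j‖) + ‖l‖ ^ 2 := by
    have h1 := norm_add_sq (𝕜 := ℂ) z (l • (e j : Cn n))
    have h2 : RCLike.re (inner ℂ z (l • (e j : Cn n))) ≤ ‖l‖ * ‖z j‖ := by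
      refine (RCLike.re_le_norm _).trans ?_
      rw [inner_smul_right, norm_mul, norm_inner_symm, inner_e]
    rw [norm_smul, norm_e, mul_one] at h1
    linarith
  have hls : ‖l‖ ≤ s / 8 := by nlinarith
  -- Both `|l|` and `|z j|` are of order `|1 - z₁|^(1/2)`, so the change of `‖z‖²` is of order `|1 -
  -- z₁|`.
  have h3 : R * (2 * (‖l‖ * ‖z j‖) + ‖l‖ ^ 2) ≤ R * ((1 - ‖z‖ ^ 2) / 2) := by
    have a1 : R * ‖l‖ * ‖z j‖ ≤ s / 8 * (2 * s) :=
      mul_le_mul hRl hzj (norm_nonneg _) (by positivity)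
    have a2 : R * ‖l‖ * ‖l‖ ≤ s / 8 * (s / 8) := mul_le_mul hRl hls hl0 (by positivity)
    nlinarith
  have h4 : 2 * (‖l‖ * ‖z j‖) + ‖l‖ ^ 2 ≤ (1 - ‖z‖ ^ 2) / 2 :=
    le_of_mul_le_mul_left h3 (by linarith)
  have hhalf : (1 - ‖z‖ ^ 2) / 2 ≤ 1 - ‖z + l • (e j : Cn n)‖ ^ 2 := by linarith
  refine ⟨⟨mem_ball_iff.2 (by nlinarith [norm_nonneg (z + l • (e j : Cn n))]), ?_⟩, he⟩
  rw [he]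
  have := mul_le_mul_of_nonneg_left hhalf (by linarith : 0 ≤ R)
  nlinarith

end Geometry

/-! ### Derivative bounds in Korányi regions. -/

section Bounds

variable {G : Cn n → Cn n}

lemma exists_weighted_bound {k : Fin n} {a : ℝ} {f : Cn n → ℝ}
    (hf : ∀ z : Cn n, ‖f z‖ = ‖G z k‖ / ‖1 - z 0‖ ^ a) (h : BoundedInKoranyi f) {R : ℝ}
    (hR : 1 ≤ R) : ∃ C : ℝ, 0 ≤ C ∧ ∀ z ∈ koranyi n R, ‖G z k‖ ≤ C * ‖1 - z 0‖ ^ a := by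
  obtain ⟨C, hC⟩ := h R hR
  refine ⟨max C 0, le_max_right _ _, fun z hz => ?_⟩
  have h1 := hC z hz
  have h2 : 0 < ‖1 - z 0‖ ^ a := Real.rpow_pos_of_pos (koranyi_pos hz) a
  rw [hf, div_le_iff₀ h2] at h1
  exact h1.trans (mul_le_mul_of_nonneg_right (le_max_left _ _) h2.le)

/-- Derivative bounds in the normal direction. -/
lemma exists_fderiv_normal_bound (hG : DifferentiableOn ℂ G (ball n)) {k : Fin n} {a : ℝ}
    (ha0 : 0 ≤ a) (hb : ∀ R : ℝ, 1 ≤ R →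
      ∃ C : ℝ, 0 ≤ C ∧ ∀ z ∈ koranyi n R, ‖G z k‖ ≤ C * ‖1 - z 0‖ ^ a) {R : ℝ} (hR : 1 ≤ R) :
    ∃ C : ℝ, 0 ≤ C ∧ ∀ z ∈ koranyi n R, ‖fderiv ℂ G z (e 0) k‖ * ‖1 - z 0‖ ≤
      C * ‖1 - z 0‖ ^ a := by
  obtain ⟨C, hC0, hC⟩ := hb (4 * R) (by linarith)
  refine ⟨C * 2 ^ a * (8 * R), by positivity, fun z hz => ?_⟩
  have hp := koranyi_pos hz
  have hρ : 0 < 1 / (8 * R) * ‖1 - z 0‖ := by positivity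
  have key := norm_fderiv_apply_le (differentiableOn_apply hG k) (z := z) (v := e 0) hρ
    (fun l hl => (koranyi_add_normal hR hz hl).1.1)
    (M := C * (2 * ‖1 - z 0‖) ^ a) (fun l hl => by
      refine (hC _ (koranyi_add_normal hR hz hl).1).trans ?_
      have := (koranyi_add_normal hR hz hl).2
      gcongr)
  rw [fderiv_apply_eq hG hz.1, le_div_iff₀ hρ, Real.mul_rpow zero_le_two hp.le] at key
  have hR8 : 0 < 8 * R := by linarith
  have := mul_le_mul_of_nonneg_right key hR8.le
  calc ‖fderiv ℂ G z (e 0) k‖ * ‖1 - z 0‖ =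
      ‖fderiv ℂ G z (e 0) k‖ * (1 / (8 * R) * ‖1 - z 0‖) * (8 * R) := by field_simp
    _ ≤ _ := this
    _ = _ := by ring

/-- Derivative bounds in the tangential directions. -/
lemma exists_fderiv_tangent_bound (hG : DifferentiableOn ℂ G (ball n)) {k : Fin n} {a : ℝ}
    (hb : ∀ R : ℝ, 1 ≤ R →
      ∃ C : ℝ, 0 ≤ C ∧ ∀ z ∈ koranyi n R, ‖G z k‖ ≤ C * ‖1 - z 0‖ ^ a) {j : Fin n} (hj : j ≠ 0)
    {R : ℝ} (hR : 1 ≤ R) :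
    ∃ C : ℝ, 0 ≤ C ∧ ∀ z ∈ koranyi n R, ‖fderiv ℂ G z (e j) k‖ * ‖1 - z 0‖ ^ (1 / 2 : ℝ) ≤
      C * ‖1 - z 0‖ ^ a := by
  obtain ⟨C, hC0, hC⟩ := hb (4 * R) (by linarith)
  refine ⟨C * (8 * R), by positivity, fun z hz => ?_⟩
  have hp := koranyi_pos hz
  have hρ : 0 < 1 / (8 * R) * ‖1 - z 0‖ ^ (1 / 2 : ℝ) := by positivity
  have key := norm_fderiv_apply_le (differentiableOn_apply hG k) (z := z) (v := e j) hρ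
    (fun l hl => (koranyi_add_tangent hR hz hj hl).1.1)
    (M := C * ‖1 - z 0‖ ^ a) (fun l hl => by
      have h1 := koranyi_add_tangent hR hz hj hl
      have h2 := hC _ h1.1
      rwa [h1.2] at h2)
  rw [fderiv_apply_eq hG hz.1, le_div_iff₀ hρ] at key
  have hR8 : 0 < 8 * R := by linarith
  have := mul_le_mul_of_nonneg_right key hR8.le
  calc ‖fderiv ℂ G z (e j) k‖ * ‖1 - z 0‖ ^ (1 / 2 : ℝ) =
      ‖fderiv ℂ G z (e j) k‖ * (1 / (8 * R) * ‖1 - z 0‖ ^ (1 / 2 : ℝ)) * (8 * R) := by field_simp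
    _ ≤ _ := this
    _ = _ := by ring

lemma norm_one_sub_cpow_half (z : Cn n) :
    ‖(1 - z 0) ^ (1 / 2 : ℂ)‖ = ‖1 - z 0‖ ^ (1 / 2 : ℝ) := by
  have := Complex.norm_cpow_real (1 - z 0) (1 / 2)
  push_cast at this
  exact this

end Bounds

/-! ### Restricted limits: passage from the slice, and derivatives. -/

section RestrictedLimit

lemma one_sub_norm_apply_sq_pos {z : Cn n} (hz : z ∈ ball n) : 0 < 1 - ‖z 0‖ ^ 2 :=
  one_sub_norm_sq_pos ((norm_apply_le z 0).trans_lt (mem_ball_iff.1 hz))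

lemma mem_koranyi_of_restricted {z : Cn n} {C s : ℝ} (hC : 0 < C) (hz : z ∈ ball n)
    (hs : ‖z - z 0 • (e 0 : Cn n)‖ ^ 2 ≤ s * (1 - ‖z 0‖ ^ 2)) (hs2 : s ≤ 1 / 2)
    (hnt : ‖z 0 - 1‖ ≤ C * (1 - ‖z 0‖ ^ 2)) : z ∈ koranyi n (max 1 (4 * C)) := by
  refine ⟨hz, ?_⟩
  have h1 := norm_sq_eq_slice_add z
  have h2 := one_sub_norm_apply_sq_pos hz
  rw [norm_sub_rev]
  have h3 : (1 - ‖z 0‖ ^ 2) / 2 ≤ 1 - ‖z‖ ^ 2 := by nlinarith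
  have h4 := le_max_right 1 (4 * C)
  have h5 := mul_le_mul_of_nonneg_left h3 hC.le
  nlinarith

/-- Cauchy estimates need uniformity over whole discs, which the sequential definition yields by
contradiction: counterexamples for `δ = 1 / (k + 1)` would form a restricted sequence. -/
lemma HasRestrictedKLimit.exists_delta {f : Cn n → ℂ} {L : ℂ} (h : HasRestrictedKLimit f L) {C ε : ℝ} (hC : 0 < C)
    (hε : 0 < ε) : ∃ δ > 0, ∀ z ∈ ball n, ‖z 0 - 1‖ ≤ δ →
      ‖z - z 0 • (e 0 : Cn n)‖ ^ 2 ≤ δ * (1 - ‖z 0‖ ^ 2) → ‖z 0 - 1‖ ≤ C * (1 - ‖z 0‖ ^ 2) →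
      ‖f z - L‖ < ε := by
  by_contra! hcon
  choose z hz h1 h2 h3 h4 using fun k : ℕ => hcon (1 / ((k : ℝ) + 1)) (by positivity)
  have hδ := tendsto_one_div_add_atTop_nhds_zero_nat (𝕜 := ℝ)
  have hlim : Tendsto z atTop (𝓝 (e 0)) := by
    rw [tendsto_iff_norm_sub_tendsto_zero]
    have hb := hδ.add hδ.sqrt
    simp only [Real.sqrt_zero, add_zero] at hb
    refine squeeze_zero (fun _ => norm_nonneg _) (fun k => ?_) hb
    have e1 : z k - e 0 = (z k 0 - 1) • (e 0 : Cn n) + (z k - z k 0 • (e 0 : Cn n)) := by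
      rw [sub_smul, one_smul]; abel
    rw [e1]
    refine (norm_add_le _ _).trans (add_le_add ?_ ?_)
    · rw [norm_smul_e]; exact h1 k
    · apply Real.le_sqrt_of_sq_le
      refine (h2 k).trans (mul_le_of_le_one_right (by positivity) ?_)
      linarith [sq_nonneg ‖z k 0‖]
  have hratio : Tendsto (fun k => ‖z k - (z k 0) • (e 0 : Cn n)‖ ^ 2 / (1 - ‖z k 0‖ ^ 2)) atTop
      (𝓝 0) := by
    refine squeeze_zero (fun k => ?_) (fun k => ?_) hδ
    · have := one_sub_norm_apply_sq_pos (hz k)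
      positivity
    · rw [div_le_iff₀ (one_sub_norm_apply_sq_pos (hz k))]
      exact h2 k
  have hlimf := h z hz hlim hratio ⟨C, hC, h3⟩
  obtain ⟨k, hk⟩ := ((Metric.tendsto_nhds.1 hlimf) ε hε).exists
  rw [dist_eq_norm] at hk
  exact absurd hk (not_lt.2 (h4 k))

lemma tendsto_apply_zero {z : ℕ → Cn n} (hlim : Tendsto z atTop (𝓝 (e 0))) :
    Tendsto (fun k => z k 0) atTop (𝓝 1) := by
  have := ((EuclideanSpace.proj (𝕜 := ℂ) (0 : Fin n)).continuous.tendsto (e 0 : Cn n)).comp hlim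
  simpa [e_apply, Function.comp_def] using this

lemma eventually_restricted {z : ℕ → Cn n} (hz : ∀ k, z k ∈ ball n)
    (hlim : Tendsto z atTop (𝓝 (e 0)))
    (hr : Tendsto (fun k => ‖z k - (z k 0) • (e 0 : Cn n)‖ ^ 2 / (1 - ‖z k 0‖ ^ 2)) atTop (𝓝 0))
    {δ : ℝ} (hδ : 0 < δ) : ∀ᶠ k in atTop, ‖z k 0 - 1‖ ≤ δ ∧
      ‖z k - z k 0 • (e 0 : Cn n)‖ ^ 2 ≤ δ * (1 - ‖z k 0‖ ^ 2) := by
  have h1 := (tendsto_iff_norm_sub_tendsto_zero.1 (tendsto_apply_zero hlim)).eventually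
    (ge_mem_nhds hδ)
  filter_upwards [h1, hr.eventually (ge_mem_nhds hδ)] with k h2 h3
  exact ⟨h2, (div_le_iff₀ (one_sub_norm_apply_sq_pos (hz k))).1 h3⟩

/-- Comparison of a function bounded on a Korányi region with its values on the slice. -/
lemma norm_sub_slice_le {f : Cn n → ℂ} (hf : DifferentiableOn ℂ f (ball n)) {C M ρ : ℝ}
    (hC : 0 < C) (hM : ∀ z ∈ koranyi n (max 1 (4 * C)), ‖f z‖ ≤ M) (hρ : 1 < ρ) {z : Cn n}
    (hz : z ∈ ball n) (hnt : ‖z 0 - 1‖ ≤ C * (1 - ‖z 0‖ ^ 2))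
    (hs : ‖z - z 0 • (e 0 : Cn n)‖ ^ 2 ≤ 1 / (2 * ρ ^ 2) * (1 - ‖z 0‖ ^ 2)) :
    ‖f z - f (z 0 • (e 0 : Cn n))‖ ≤ 2 * M / ρ := by
  have hd := one_sub_norm_apply_sq_pos hz
  set v := z - z 0 • (e 0 : Cn n) with hv
  have hv0 : v 0 = 0 := by simp [hv, e_apply]
  -- By `hs`, `ρ² ‖v‖² ≤ (1 - |z₁|²) / 2`, so the whole transverse disc of radius `ρ` stays in the
  -- region. The slice point sits at `l = 0` and `z` at `l = 1`.
  have hmem : ∀ l ∈ Metric.ball (0 : ℂ) ρ,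
      z 0 • (e 0 : Cn n) + l • v ∈ koranyi n (max 1 (4 * C)) := by
    intro l hl
    have hl' : ‖l‖ < ρ := by simpa using hl
    set w := z 0 • (e 0 : Cn n) + l • v with hw
    have hw0 : w 0 = z 0 := by simp [hw, e_apply, hv0]
    have hw1 : w - w 0 • (e 0 : Cn n) = l • v := by rw [hw0, hw]; abel
    have hn : ‖w - w 0 • (e 0 : Cn n)‖ ^ 2 ≤ 1 / 2 * (1 - ‖w 0‖ ^ 2) := by
      rw [hw1, hw0, norm_smul, mul_pow]
      calc ‖l‖ ^ 2 * ‖v‖ ^ 2 ≤ ρ ^ 2 * (1 / (2 * ρ ^ 2) * (1 - ‖z 0‖ ^ 2)) := by gcongr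
        _ = _ := by field_simp
    have hwb : w ∈ ball n := by
      have h1 := norm_sq_eq_slice_add w
      rw [mem_ball_iff]
      rw [hw0] at hn h1
      nlinarith [norm_nonneg w]
    exact mem_koranyi_of_restricted hC hwb hn le_rfl (by rwa [hw0])
  have hline : Differentiable ℂ fun l : ℂ => z 0 • (e 0 : Cn n) + l • v :=
    (differentiable_id.smul_const v).const_add _
  have h0 : (0 : ℂ) ∈ Metric.ball (0 : ℂ) ρ := Metric.mem_ball_self (by linarith)
  have key := Complex.dist_le_div_mul_dist_of_mapsTo_ball (R₁ := ρ) (R₂ := 2 * M) (c := (0 : ℂ))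
    (z := 1) (f := fun l : ℂ => f (z 0 • (e 0 : Cn n) + l • v))
    (hf.comp hline.differentiableOn fun l hl => (hmem l hl).1)
    (fun l hl => by
      rw [Metric.mem_closedBall, dist_eq_norm]
      refine (norm_sub_le _ _).trans ?_
      linarith [hM _ (hmem l hl), hM _ (hmem 0 h0)]) (by simpa using hρ)
  simpa [dist_eq_norm, hv] using key

/-- A function bounded in Korányi regions with a non-tangential limit along the slice has the
same restricted `K`-limit. -/
theorem hasRestrictedKLimit_of_slice {f : Cn n → ℂ} {L : ℂ} (hf : DifferentiableOn ℂ f (ball n))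
    (hb : BoundedInKoranyi f)
    (hslice : ∀ (ζ : ℕ → ℂ) (C : ℝ), 0 < C → (∀ k, ‖ζ k‖ < 1) → Tendsto ζ atTop (𝓝 1) →
      (∀ k, ‖ζ k - 1‖ ≤ C * (1 - ‖ζ k‖ ^ 2)) →
      Tendsto (fun k => f (ζ k • (e 0 : Cn n))) atTop (𝓝 L)) :
    HasRestrictedKLimit f L := by
  rintro z hz hlim hr ⟨C, hC, hnt⟩
  have hs := hslice (fun k => z k 0) C hC
    (fun k => (norm_apply_le (z k) 0).trans_lt (mem_ball_iff.1 (hz k))) (tendsto_apply_zero hlim) hnt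
  obtain ⟨M, hM⟩ := hb (max 1 (4 * C)) (le_max_left _ _)
  have hdiff : Tendsto (fun k => f (z k) - f (z k 0 • (e 0 : Cn n))) atTop (𝓝 0) := by
    rw [Metric.tendsto_nhds]
    intro ε hε
    obtain ⟨ρ, hρ1, hρ⟩ : ∃ ρ : ℝ, 1 < ρ ∧ 2 * M / ρ < ε := by
      have h1 : Tendsto (fun ρ : ℝ => 2 * M / ρ) atTop (𝓝 0) :=
        tendsto_const_nhds.div_atTop tendsto_id
      obtain ⟨ρ, h2, h3⟩ := ((h1.eventually (gt_mem_nhds hε)).and (eventually_gt_atTop 1)).exists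
      exact ⟨ρ, h3, h2⟩
    filter_upwards [eventually_restricted hz hlim hr (δ := 1 / (2 * ρ ^ 2)) (by positivity)]
      with k hk
    rw [dist_zero_right]
    exact (norm_sub_slice_le hf hC hM hρ1 (hz k) (hnt k) hk.2).trans_lt hρ
  simpa using hdiff.add hs

/-- Cauchy estimates: the normal derivative of a function with a restricted `K`-limit is
`o(1 / |1 - z₁|)`. -/
theorem hasRestrictedKLimit_mul_fderiv {f : Cn n → ℂ} {L : ℂ} (hf : DifferentiableOn ℂ f (ball n))
    (h : HasRestrictedKLimit f L) :
    HasRestrictedKLimit (fun z => (z 0 - 1) * fderiv ℂ f z (e 0)) 0 := by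
  rintro z hz hlim hr ⟨C, hC, hnt⟩
  rw [Metric.tendsto_nhds]
  intro ε hε
  -- Chosen so that `c |w₁ - 1| ≤ (1 - |w₁|²) / 8` on the non-tangential region.
  set c : ℝ := 1 / (8 * (C + 1)) with hc
  have hc0 : 0 < c := by positivity
  have hcC : c * (8 * (C + 1)) = 1 := by rw [hc]; field_simp
  -- On the disc, `|w₁ - 1|` at most doubles and `1 - |w₁|²` at most halves: hence `4 * C` and the
  -- threshold `δ / 2`. The threshold `1 / 4` keeps the disc in the ball, and the factor `c` cancels
  -- against the radius.
  obtain ⟨δ, hδ, hb⟩ := h.exists_delta (C := 4 * C) (ε := ε / 2 * c) (by positivity)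
    (by positivity)
  filter_upwards [eventually_restricted hz hlim hr (δ := min (δ / 2) (1 / 4)) (by positivity)]
    with k hk
  have hntk := hnt k
  have hzk := hz k
  generalize z k = w at hk hntk hzk
  have hd := one_sub_norm_apply_sq_pos hzk
  have hw1 : 0 < ‖w 0 - 1‖ := norm_pos_iff.2 (sub_one_ne_zero hzk)
  have hm1 : min (δ / 2) (1 / 4) ≤ δ / 2 := min_le_left _ _
  have hm2 : min (δ / 2) (1 / 4) ≤ 1 / 4 := min_le_right _ _
  have hρ : 0 < c * ‖w 0 - 1‖ := by positivity
  have hpt : ∀ l : ℂ, ‖l‖ ≤ c * ‖w 0 - 1‖ → w + l • (e 0 : Cn n) ∈ ball n ∧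
      ‖f (w + l • (e 0 : Cn n)) - L‖ < ε / 2 * c := by
    intro l hl
    have hl0 := norm_nonneg l
    have hl1 : ‖l‖ ≤ (1 - ‖w 0‖ ^ 2) / 8 := by
      have a1 : c * ‖w 0 - 1‖ ≤ c * (C * (1 - ‖w 0‖ ^ 2)) := by gcongr
      have a2 : c * C ≤ 1 / 8 := by linarith
      nlinarith
    have hl2 : ‖l‖ ≤ ‖w 0 - 1‖ := by nlinarith
    set p := w + l • (e 0 : Cn n) with hp
    have hp0 : p 0 = w 0 + l := by simp [hp, e_apply]
    have hp1 : p - p 0 • (e 0 : Cn n) = w - w 0 • (e 0 : Cn n) := by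
      rw [hp0, hp, add_smul]; abel
    have hnorm : ‖p 0‖ ≤ ‖w 0‖ + ‖l‖ := by rw [hp0]; exact norm_add_le _ _
    have hw01 : ‖w 0‖ < 1 := (norm_apply_le w 0).trans_lt (mem_ball_iff.1 hzk)
    have hsq := pow_le_pow_left₀ (norm_nonneg _) hnorm 2
    have hhalf : (1 - ‖w 0‖ ^ 2) / 2 ≤ 1 - ‖p 0‖ ^ 2 := by
      nlinarith [norm_nonneg (w 0)]
    have hdist : ‖p 0 - 1‖ ≤ 2 * ‖w 0 - 1‖ := by
      rw [hp0, show w 0 + l - 1 = (w 0 - 1) + l by ring]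
      linarith [norm_add_le (w 0 - 1) l]
    have hpb : p ∈ ball n := by
      have a1 := norm_sq_eq_slice_add p
      rw [hp1] at a1
      rw [mem_ball_iff]
      nlinarith [norm_nonneg p, hk.2]
    refine ⟨hpb, hb p hpb ?_ ?_ ?_⟩
    · linarith [hk.1]
    · rw [hp1]
      nlinarith [hk.2]
    · nlinarith
  have hfd : DifferentiableOn ℂ (fun z => f z - L) (ball n) := hf.sub_const L
  have key := norm_fderiv_apply_le hfd hρ (fun l hl => (hpt l hl).1) (fun l hl => (hpt l hl).2.le)
  rw [fderiv_sub_const, le_div_iff₀ hρ] at key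
  rw [dist_zero_right, norm_mul]
  have : c * (‖w 0 - 1‖ * ‖fderiv ℂ f w (e 0)‖) ≤ c * (ε / 2) := by linarith
  linarith [le_of_mul_le_mul_left this hc0]

end RestrictedLimit

end UnitBall

end

/-! ### The quotient's product rule and assembly of the theorem. -/

noncomputable section

namespace UnitBall

open Set HolomorphicBall

variable {n : ℕ} [NeZero n] {G : Cn n → Cn n}

lemma boundedInKoranyi_normalQuotient
    (h₁ : BoundedInKoranyi (fun z : Cn n => ‖G z 0‖ / ‖z 0 - 1‖)) :
    BoundedInKoranyi (normalQuotient G) := fun R hR => by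
  obtain ⟨C, hC⟩ := h₁ R hR
  refine ⟨C, fun z hz => ?_⟩
  have := hC z hz
  rwa [norm_div, norm_norm, norm_norm, ← norm_div] at this

lemma fderiv_normal_eq (hG : DifferentiableOn ℂ G (ball n)) {z : Cn n} (hz : z ∈ ball n) :
    fderiv ℂ G z (e 0) 0 =
      normalQuotient G z + (z 0 - 1) * fderiv ℂ (normalQuotient G) z (e 0) := by
  have hnhds : ball n ∈ 𝓝 z := Metric.isOpen_ball.mem_nhds hz
  have hq : HasFDerivAt (normalQuotient G) (fderiv ℂ (normalQuotient G) z) z :=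
    ((differentiableOn_normalQuotient hG).differentiableAt hnhds).hasFDerivAt
  have hp : HasFDerivAt (fun w : Cn n => w 0 - 1) (EuclideanSpace.proj (𝕜 := ℂ) (0 : Fin n)) z :=
    (EuclideanSpace.proj (𝕜 := ℂ) (0 : Fin n)).hasFDerivAt.sub_const 1
  have heq : (fun w : Cn n => G w 0) =ᶠ[𝓝 z] fun w => (w 0 - 1) * normalQuotient G w := by
    filter_upwards [hnhds] with w hw
    rw [normalQuotient, mul_div_cancel₀ _ (sub_one_ne_zero hw)]
  rw [← fderiv_apply_eq hG hz, heq.fderiv_eq, (hp.fun_mul hq).fderiv]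
  simp [e_apply]
  ring

end UnitBall

end

theorem theorem1p2 (n : ℕ) [NeZero n] (G : UnitBall.Cn n → UnitBall.Cn n)
    (hG : UnitBall.IsInfinitesimalGenerator G)
    (h₁ : UnitBall.BoundedInKoranyi (fun z : UnitBall.Cn n => ‖G z 0‖ / ‖z 0 - 1‖))
    (h₂ : ∀ j : Fin n, j ≠ 0 →
      UnitBall.BoundedInKoranyi
        (fun z : UnitBall.Cn n => ‖G z j‖ / ‖z 0 - 1‖ ^ (1 / 2 : ℝ))) :
    UnitBall.IsBRNP G ∧
    -- (1')
    UnitBall.BoundedInKoranyi (fun z : UnitBall.Cn n => fderiv ℂ G z (UnitBall.e 0) 0) ∧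
    (∀ h k : Fin n, h ≠ 0 → k ≠ 0 →
      UnitBall.BoundedInKoranyi (fun z : UnitBall.Cn n => fderiv ℂ G z (UnitBall.e h) k)) ∧
    -- (1'')
    (∀ j : Fin n, j ≠ 0 →
      UnitBall.BoundedInKoranyi
        (fun z : UnitBall.Cn n => fderiv ℂ G z (UnitBall.e j) 0 / (1 - z 0) ^ (1 / 2 : ℂ))) ∧
    -- (1''')
    (∀ j : Fin n, j ≠ 0 →
      UnitBall.BoundedInKoranyi
        (fun z : UnitBall.Cn n => (1 - z 0) ^ (1 / 2 : ℂ) * fderiv ℂ G z (UnitBall.e 0) j)) ∧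
    -- (2)
    UnitBall.HasRestrictedKLimit
      (fun z : UnitBall.Cn n => G z 0 / (z 0 - 1)) (UnitBall.dilation G : ℂ) ∧
    -- (3)
    UnitBall.HasRestrictedKLimit
      (fun z : UnitBall.Cn n => fderiv ℂ G z (UnitBall.e 0) 0) (UnitBall.dilation G : ℂ) ∧
    -- (4)
    (∀ j : Fin n, j ≠ 0 →
      UnitBall.HasRestrictedKLimit
        (fun z : UnitBall.Cn n => fderiv ℂ G z (UnitBall.e j) 0) 0) := by
  have hb₁ : ∀ R : ℝ, 1 ≤ R → ∃ C : ℝ, 0 ≤ C ∧ ∀ z ∈ UnitBall.koranyi n R,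
      ‖G z 0‖ ≤ C * ‖1 - z 0‖ ^ (1 : ℝ) := fun R hR =>
    UnitBall.exists_weighted_bound (fun z => by
      rw [norm_div, norm_norm, norm_norm, Real.rpow_one, norm_sub_rev]) h₁ hR
  have hb₂ : ∀ j : Fin n, j ≠ 0 → ∀ R : ℝ, 1 ≤ R → ∃ C : ℝ, 0 ≤ C ∧ ∀ z ∈ UnitBall.koranyi n R,
      ‖G z j‖ ≤ C * ‖1 - z 0‖ ^ (1 / 2 : ℝ) := fun j hj R hR =>
    UnitBall.exists_weighted_bound (fun z => by
      rw [norm_div, norm_norm, Real.norm_of_nonneg (by positivity), norm_sub_rev]) (h₂ j hj) hR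
  obtain ⟨b, hb⟩ := UnitBall.exists_rate_le hG h₁ h₂
  have hlim : UnitBall.HasRestrictedKLimit (UnitBall.normalQuotient G) (UnitBall.dilation G : ℂ) :=
    UnitBall.hasRestrictedKLimit_of_slice (UnitBall.differentiableOn_normalQuotient hG.1)
      (UnitBall.boundedInKoranyi_normalQuotient h₁) fun _ _ hC hζ hlim hnt =>
        UnitBall.tendsto_normalQuotient_slice hG h₁ h₂ hζ hlim hC hnt
  refine ⟨UnitBall.isBRNP_of_rate_le hb, fun R hR => ?_, fun h k hh hk R hR => ?_,
    fun j hj R hR => ?_, fun j hj R hR => ?_, hlim, ?_, fun j hj => ?_⟩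
  · obtain ⟨C, -, hC⟩ := UnitBall.exists_fderiv_normal_bound hG.1 zero_le_one hb₁ hR
    refine ⟨C, fun z hz => ?_⟩
    have h1 := hC z hz
    rw [Real.rpow_one] at h1
    exact le_of_mul_le_mul_right h1 (UnitBall.koranyi_pos hz)
  · obtain ⟨C, -, hC⟩ := UnitBall.exists_fderiv_tangent_bound hG.1 (hb₂ k hk) hh hR
    exact ⟨C, fun z hz => le_of_mul_le_mul_right (hC z hz)
      (Real.rpow_pos_of_pos (UnitBall.koranyi_pos hz) _)⟩
  · obtain ⟨C, -, hC⟩ := UnitBall.exists_fderiv_tangent_bound hG.1 hb₁ hj hR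
    refine ⟨C, fun z hz => ?_⟩
    have hp := UnitBall.koranyi_pos hz
    have hs : 0 < ‖1 - z 0‖ ^ (1 / 2 : ℝ) := Real.rpow_pos_of_pos hp _
    rw [norm_div, UnitBall.norm_one_sub_cpow_half, div_le_iff₀ hs]
    refine le_of_mul_le_mul_right ((hC z hz).trans_eq ?_) hs
    rw [mul_assoc, ← Real.rpow_add hp]
    norm_num
  · obtain ⟨C, -, hC⟩ := UnitBall.exists_fderiv_normal_bound hG.1 (by norm_num) (hb₂ j hj) hR
    refine ⟨C, fun z hz => ?_⟩
    have hp := UnitBall.koranyi_pos hz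
    have hs : 0 < ‖1 - z 0‖ ^ (1 / 2 : ℝ) := Real.rpow_pos_of_pos hp _
    rw [norm_mul, UnitBall.norm_one_sub_cpow_half]
    refine le_of_mul_le_mul_right (le_of_eq_of_le ?_ (hC z hz)) hs
    have e1 : ‖1 - z 0‖ ^ (1 / 2 : ℝ) * ‖1 - z 0‖ ^ (1 / 2 : ℝ) = ‖1 - z 0‖ := by
      rw [← Real.rpow_add hp]
      norm_num
    rw [mul_right_comm, e1, mul_comm]
  -- Conclusion (3): the product rule splits the derivative into the quotient, tending to the
  -- dilation, and a term tending to `0`.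
  · intro z hz hz0 hr hC
    have h1 := (hlim z hz hz0 hr hC).add (UnitBall.hasRestrictedKLimit_mul_fderiv
      (UnitBall.differentiableOn_normalQuotient hG.1) hlim z hz hz0 hr hC)
    rw [add_zero] at h1
    exact h1.congr fun k => (UnitBall.fderiv_normal_eq hG.1 (hz k)).symm
  -- Conclusion (4): restricted sequences eventually enter a fixed Korányi region, where the
  -- derivative is `O(|1 - z₁|^(1/2))`.
  · rintro z hz hz0 hr ⟨C, hC, hnt⟩
    obtain ⟨B, -, hB⟩ := UnitBall.exists_fderiv_tangent_bound hG.1 hb₁ hj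
      (le_max_left 1 (4 * C))
    have hz1 : Tendsto (fun k => B * ‖1 - z k 0‖ ^ (1 / 2 : ℝ)) atTop (𝓝 0) := by
      have h1 := ((UnitBall.tendsto_apply_zero hz0).const_sub 1).norm
      have h2 := (h1.rpow_const (p := 1 / 2) (Or.inr (by norm_num))).const_mul B
      simpa using h2
    refine squeeze_zero_norm' ?_ hz1
    filter_upwards [UnitBall.eventually_restricted hz hz0 hr (δ := 1 / 2) (by norm_num)] with k hk
    have hK := UnitBall.mem_koranyi_of_restricted hC (hz k) hk.2 le_rfl (hnt k)
    have hp := UnitBall.koranyi_pos hK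
    have hs : 0 < ‖1 - z k 0‖ ^ (1 / 2 : ℝ) := Real.rpow_pos_of_pos hp _
    refine le_of_mul_le_mul_right ((hB _ hK).trans_eq ?_) hs
    rw [mul_assoc, ← Real.rpow_add hp]
    norm_num
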